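/- Let $\{0,1\}^{\omega}$ be the Cantor space of left-infinite words $\ldots x_2x_1x_0$ over $\{0,1\}$, and write $g=\sigma(g_0,g_1)$ if $(vx)\cdot g=(v\cdot g_x)\,\sigma(x)$ for all words $v$ and letters $x$ (no $\sigma$ is written if it is trivial). Let $a=\sigma$ (with $\sigma=(0\,1)$), $b=(1,a)$, $c=(c,b)$ be the generators of $\mathfrak K(11,0)$. For $j\in\{0,1,2\}$ let $P_j=\bigcup_{k\ge 0}\{0,1\}^{\omega}1\,0^{3k+j}$. Let $c_0,c_1,c_2$ be the homeomorphisms that act as $c$ on $P_0\cup P_1$, $P_0\cup P_2$, $P_1\cup P_2$, respectively, and as the identity elsewhere. Put $S=\{a,b,c_0,c_1,c_2\}$, $G=\langle S\rangle$ and $\xi=0^{\omega}$. Definitions. For a point $\zeta$ let $G_\zeta$ be its stabilizer, $G_{(\zeta)}$ the subgroup of elements fixing a neighborhood of $\zeta$ pointwise, and $G_\zeta/G_{(\zeta)}$ its group of germs; $\zeta$ is singular if this group is non-trivial. A singular point $\zeta$ is germ-defining if (i) $\zeta$ is the only point $\zeta'$ of its $G$-orbit such that some $s\in S$ fixes $\zeta'$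 but does not fix a neighborhood of $\zeta'$ pointwise; and (ii) whenever $\zeta'\in G\zeta$, $m\ge2$, $s_1,\dots,s_m\in S\cup S^{-1}$ are such that the points $\zeta', s_1(\zeta'),\dots,s_{m-1}\cdots s_1(\zeta')$ are pairwise distinct and $s_m\cdots s_1(\zeta')=\zeta'$, the element $s_m\cdots s_1$ fixes a neighborhood of $\zeta'$ pointwise. It is a purely non-Hausdorff singularity if it is germ-defining and for every $g\in G_\zeta$ the interior of the fixed point set of $g$ accumulates on $\zeta$. A fragmentation of a homeomorphism $h$ of finite order, with respect to a finite partition of $\{x: h(x)\ne x\}$ into $h$-invariant open pieces, is a finite group $F$ of homeomorphisms such that every $g\in F$ is trivial on the fixed points of $h$ and coincides on each piece with some power of $h$, and such that on each piece $P$ every restriction $h^k|_P$ is realized by some element of $F$. A fragmentation of a group with a given finite generating set is a group generated by fragmentations of its generators. With $|g|$ the word length with respect to $S$, let $\gamma_G(R)=\#\{g\in G: |g|\le R\}$, and write $f_1\preccurlyeq f_2$ if there is $C\ge1$ with $f_1(R)\le f_2(CR)$ for all $R\ge1$. Then: 1. $c_0=(c_1,b)$, $c_1=(c_2,b)$, $c_2=(c_0,1)$.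 2. $\langle c_0,c_1,c_2\rangle$ is a fragmentation of $c$ with respect to the pieces $P_j\cap\{x: c(x)\neq x\}$, $j=0,1,2$, and $G$ is a fragmentation of $\mathfrak K(11,0)=\langle a,b,c\rangle$. 3. $\xi$ is the unique purely non-Hausdorff singularity of $G$. 4. $\langle c_0,c_1,c_2\rangle\cong(\mathbb Z/2\mathbb Z)^2$ fixes $\xi$, every element of $G_\xi$ has the same germ at $\xi$ as exactly one element of $\langle c_0,c_1,c_2\rangle$, and $G_\xi/G_{(\xi)}\cong(\mathbb Z/2\mathbb Z)^2$. 5. The polynomial $x^5+x^4+x^3-2$ has exactly one positive root $\eta$, $|\eta-0.9028|<0.00005$, $\left|\frac{\log 2}{\log 2-\log\eta}-0.8715\right|<0.00005$, and $$\gamma_G(R)\preccurlyeq\exp(R^{\alpha})\quad\text{for every }\alpha>\frac{\log 2}{\log 2-\log\eta}.$$ -/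

import Mathlib

open Topology Filter

namespace FragK110

section Growth

/-- Word length with respect to the letters in `S ∪ S⁻¹` (meaningful on the subgroup generated
by `S`). -/
noncomputable def wordLength {Γ : Type*} [Group Γ] (S : Set Γ) (g : Γ) : ℕ :=
  sInf {n : ℕ | ∃ l : List Γ, (∀ s ∈ l, s ∈ S ∨ s⁻¹ ∈ S) ∧ l.prod = g ∧ l.length = n}

/-- The ball of radius `R` in the group generated by `S`. -/
def wordBall {Γ : Type*} [Group Γ] (S : Set Γ) (R : ℝ) : Set Γ :=
  {g : Γ | g ∈ Subgroup.closure S ∧ (wordLength S g : ℝ) ≤ R}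

/-- The growth function `γ(R)` of the group generated by `S`. -/
noncomputable def growth {Γ : Type*} [Group Γ] (S : Set Γ) (R : ℝ) : ℕ := (wordBall S R).ncard

theorem exists_word {Γ : Type*} [Group Γ] (S : Set Γ) {g : Γ} (hg : g ∈ Subgroup.closure S) :
    ∃ l : List Γ, (∀ s ∈ l, s ∈ S ∨ s⁻¹ ∈ S) ∧ l.prod = g ∧ l.length = wordLength S g := by
  have hne : {n : ℕ | ∃ l : List Γ, (∀ s ∈ l, s ∈ S ∨ s⁻¹ ∈ S) ∧ l.prod = g ∧
      l.length = n}.Nonempty := by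
    rw [← Subgroup.mem_toSubmonoid, Subgroup.closure_toSubmonoid] at hg
    obtain ⟨l, hl, hp⟩ := Submonoid.exists_list_of_mem_closure hg
    exact ⟨l.length, l, fun s hs => by simpa using hl s hs, hp, rfl⟩
  exact Nat.sInf_mem hne

/-- For finite `S` the balls are finite, so that `growth` really counts their elements. -/
theorem wordBall_finite {Γ : Type*} [Group Γ] (S : Set Γ) (hS : S.Finite) (R : ℝ) :
    (wordBall S R).Finite := by
  have hT : (S ∪ S⁻¹).Finite := hS.union hS.inv
  have : Finite ↥(S ∪ S⁻¹) := hT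
  refine ((List.finite_length_le ↥(S ∪ S⁻¹) ⌊R⌋₊).image
    (fun l => (l.map Subtype.val).prod)).subset ?_
  rintro g ⟨hg, hR⟩
  obtain ⟨l, hl, hp, hlen⟩ := exists_word S hg
  refine ⟨l.attach.map (fun s => ⟨s.1, by simpa using hl s.1 s.2⟩), ?_, ?_⟩
  · simp only [Set.mem_ofPred_eq, List.length_map, List.length_attach, hlen]
    exact Nat.le_floor hR
  · simp [List.map_map, Function.comp_def, hp]

/-- `f₁ ≼ f₂`: there is `C ≥ 1` with `f₁ R ≤ f₂ (C R)` for all `R ≥ 1`. -/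
def Dominated (f₁ f₂ : ℝ → ℝ) : Prop :=
  ∃ C : ℝ, 1 ≤ C ∧ ∀ R : ℝ, 1 ≤ R → f₁ R ≤ f₂ (C * R)

end Growth

section Germs

/-- The stabilizer `G_ζ` of a point. -/
def pointStab {X : Type*} [TopologicalSpace X] (G : Subgroup (X ≃ₜ X)) (ζ : X) :
    Subgroup (X ≃ₜ X) where
  carrier := {g | g ∈ G ∧ g ζ = ζ}
  one_mem' := ⟨G.one_mem, rfl⟩
  mul_mem' := by
    rintro g h ⟨hg, hg'⟩ ⟨hh, hh'⟩
    exact ⟨G.mul_mem hg hh, by rw [Homeomorph.mul_apply, hh', hg']⟩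
  inv_mem' := by
    rintro g ⟨hg, hg'⟩
    refine ⟨G.inv_mem hg, ?_⟩
    rw [Homeomorph.inv_apply, Homeomorph.symm_apply_eq, hg']

/-- The neighborhood stabilizer `G_(ζ)`: the elements of `G` that fix a neighborhood of `ζ`
pointwise. -/
def nbhdStab {X : Type*} [TopologicalSpace X] (G : Subgroup (X ≃ₜ X)) (ζ : X) :
    Subgroup (X ≃ₜ X) where
  carrier := {g | g ∈ G ∧ ∀ᶠ x in 𝓝 ζ, g x = x}
  one_mem' := ⟨G.one_mem, Eventually.of_forall fun _ => rfl⟩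
  mul_mem' := by
    rintro g h ⟨hg, hg'⟩ ⟨hh, hh'⟩
    refine ⟨G.mul_mem hg hh, ?_⟩
    filter_upwards [hg', hh'] with x hx hx'
    rw [Homeomorph.mul_apply, hx', hx]
  inv_mem' := by
    rintro g ⟨hg, hg'⟩
    refine ⟨G.inv_mem hg, ?_⟩
    filter_upwards [hg'] with x hx
    rw [Homeomorph.inv_apply, Homeomorph.symm_apply_eq, hx]

instance {X : Type*} [TopologicalSpace X] (G : Subgroup (X ≃ₜ X)) (ζ : X) :
    ((nbhdStab G ζ).subgroupOf (pointStab G ζ)).Normal where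
  conj_mem := by
    rintro ⟨n, hn⟩ hn' ⟨g, hg⟩
    rw [Subgroup.mem_subgroupOf] at hn' ⊢
    refine ⟨G.mul_mem (G.mul_mem hg.1 hn'.1) (G.inv_mem hg.1), ?_⟩
    have hgζ : (g⁻¹ : X ≃ₜ X) ζ = ζ := ((pointStab G ζ).inv_mem hg).2
    have ht : Tendsto (g⁻¹ : X ≃ₜ X) (𝓝 ζ) (𝓝 ζ) := by
      have := (g⁻¹ : X ≃ₜ X).continuous.tendsto ζ
      rwa [hgζ] at this
    filter_upwards [ht.eventually hn'.2] with x hx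
    change g (n ((g⁻¹ : X ≃ₜ X) x)) = x
    change n ((g⁻¹ : X ≃ₜ X) x) = (g⁻¹ : X ≃ₜ X) x at hx
    rw [hx]
    exact g.apply_symm_apply x

/-- The group of germs `G_ζ / G_(ζ)`. -/
abbrev GermGroup {X : Type*} [TopologicalSpace X] (G : Subgroup (X ≃ₜ X)) (ζ : X) : Type _ :=
  ↥(pointStab G ζ) ⧸ (nbhdStab G ζ).subgroupOf (pointStab G ζ)

/-- `ζ` is singular for `G`: its group of germs is non-trivial. -/
def IsSingular {X : Type*} [TopologicalSpace X] (G : Subgroup (X ≃ₜ X)) (ζ : X) : Prop :=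
  Nontrivial (GermGroup G ζ)

/-- `ζ` is a singular point of the generating set `S`: some generator fixes `ζ` but no
neighborhood of `ζ` pointwise. -/
def IsSingularOfGenerators {X : Type*} [TopologicalSpace X] (S : Set (X ≃ₜ X)) (ζ : X) : Prop :=
  ∃ s ∈ S, s ζ = ζ ∧ ¬ ∀ᶠ x in 𝓝 ζ, s x = x

/-- The list `l = [s_m, …, s_1]` of letters from `S ∪ S⁻¹` labels a nonloop cycle at `ζ`:
`m ≥ 2`, the points `ζ, s_1 ζ, …, s_{m-1} ⋯ s_1 ζ` are pairwise distinct and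
`s_m ⋯ s_1 ζ = ζ`. -/
def IsNonloopCycle {X : Type*} [TopologicalSpace X] (S : Set (X ≃ₜ X)) (ζ : X)
    (l : List (X ≃ₜ X)) : Prop :=
  2 ≤ l.length ∧ (∀ s ∈ l, s ∈ S ∨ s⁻¹ ∈ S) ∧
    Set.InjOn (fun i : ℕ => (l.drop i).prod ζ) (Set.Icc 1 l.length) ∧ l.prod ζ = ζ

/-- `ξ` is a germ-defining singular point of the group generated by `S`. -/
def IsGermDefining {X : Type*} [TopologicalSpace X] (S : Set (X ≃ₜ X)) (ξ : X) : Prop :=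
  IsSingular (Subgroup.closure S) ξ ∧
  (∀ g ∈ Subgroup.closure S, IsSingularOfGenerators S (g ξ) ↔ g ξ = ξ) ∧
  (∀ g ∈ Subgroup.closure S, ∀ l : List (X ≃ₜ X), IsNonloopCycle S (g ξ) l →
    ∀ᶠ x in 𝓝 (g ξ), l.prod x = x)

/-- `ξ` is a purely non-Hausdorff singularity of the group generated by `S`: it is germ-defining,
and for every `g` in the stabilizer of `ξ` the interior of the fixed point set of `g`
accumulates on `ξ`. -/
def IsPurelyNonHausdorff {X : Type*} [TopologicalSpace X] (S : Set (X ≃ₜ X)) (ξ : X) : Prop :=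
  IsGermDefining S ξ ∧
  ∀ g ∈ Subgroup.closure S, g ξ = ξ → AccPt ξ (𝓟 (interior {x | g x = x}))

end Germs

section Fragmentations

/-- `F` is a fragmentation of the finite order homeomorphism `h` with respect to the finite
partition `Q` of the support `{x | h x ≠ x}` into `h`-invariant open sets. -/
structure IsFragmentation {X : Type*} [TopologicalSpace X] (F : Subgroup (X ≃ₜ X)) (h : X ≃ₜ X)
    (Q : Set (Set X)) : Prop where
  finite_order : IsOfFinOrder h
  finite_pieces : Q.Finite
  nonempty_pieces : ∀ P ∈ Q, P.Nonempty
  disjoint_pieces : Q.PairwiseDisjoint id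
  cover : ⋃₀ Q = {x | h x ≠ x}
  open_pieces : ∀ P ∈ Q, IsOpen P
  invariant_pieces : ∀ P ∈ Q, h '' P = P
  finite_group : Finite F
  local_power : ∀ g ∈ F, ∀ P ∈ Q, ∃ k : ℤ, Set.EqOn g (h ^ k : X ≃ₜ X) P
  fix : ∀ g ∈ F, ∀ x, h x = x → g x = x
  onto_piece : ∀ P ∈ Q, ∀ k : ℤ, ∃ g ∈ F, Set.EqOn g (h ^ k : X ≃ₜ X) P

/-- `G` is a fragmentation group of the group generated by `S`: it is generated by the union of
fragmentations `F s` of the generators `s ∈ S`. -/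
def IsFragmentationGroup {X : Type*} [TopologicalSpace X] (S : Set (X ≃ₜ X))
    (G : Subgroup (X ≃ₜ X)) : Prop :=
  ∃ F : (X ≃ₜ X) → Subgroup (X ≃ₜ X),
    (∀ s ∈ S, ∃ Q : Set (Set X), IsFragmentation (F s) s Q) ∧ G = ⨆ s ∈ S, F s

end Fragmentations

section Example

/-- The space `{0,1}^ω` of left-infinite words `… x₂ x₁ x₀` over `{0,1}` with the product
topology; `w 0` is the last (rightmost) letter of `w`. -/
abbrev Word : Type := ℕ → Fin 2

/-- The word `v` with its last letter removed: `v x ↦ v`. -/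
def init (w : Word) : Word := fun n => w (n + 1)

/-- The word `v x`, obtained by appending the letter `x` on the right. -/
def snoc (v : Word) (x : Fin 2) : Word
  | 0 => x
  | n + 1 => v n

/-- `g = σ (s 0, s 1)` in the notation of wreath recursions: `(v x) · g = (v · s x) (σ x)`. -/
def HasWreathRecursion (g : Word ≃ₜ Word) (σ : Equiv.Perm (Fin 2)) (s : Fin 2 → (Word ≃ₜ Word)) :
    Prop :=
  ∀ (v : Word) (x : Fin 2), g (snoc v x) = snoc (s x v) (σ x)

/-- The action of `a`: change the last letter. -/
def aFun (w : Word) : Word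
  | 0 => w 0 + 1
  | n + 1 => w (n + 1)

/-- The action of `b = (1, a)`. -/
def bFun (w : Word) : Word
  | 0 => w 0
  | n + 1 => if w 0 = 0 then w (n + 1) else aFun (init w) n

/-- The `n`-th letter of the image of a word under `c = (c, b)`. -/
def cLetter : ℕ → Word → Fin 2
  | 0, w => w 0
  | n + 1, w => if w 0 = 0 then cLetter n (init w) else bFun (init w) n

/-- The action of `c = (c, b)`. -/
def cFun (w : Word) : Word := fun n => cLetter n w

/-- `W n = {0,1}^ω 1 0^n`. -/
def W (n : ℕ) : Set Word := {w | (∀ k < n, w k = 0) ∧ w n = 1}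

/-- The pieces `P j = ⋃ k, W (3 k + j)`. -/
def piece (j : Fin 3) : Set Word := ⋃ k : ℕ, W (3 * k + j)

open Classical in
/-- Act as `c` on `A` and trivially elsewhere. -/
noncomputable def fragFun (A : Set Word) (w : Word) : Word := if w ∈ A then cFun w else w

/-- `A` contains or avoids each `W n`. -/
def Saturated (A : Set Word) : Prop :=
  ∀ (n : ℕ) (w w' : Word), w ∈ W n → w' ∈ W n → w ∈ A → w' ∈ A

theorem fin2_add (x : Fin 2) : x + 1 + 1 = x := by fin_cases x <;> rfl

theorem fin2_ne (x : Fin 2) (h : x ≠ 0) : x = 1 := by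
  fin_cases x
  · exact absurd rfl h
  · rfl

theorem W_unique {m n : ℕ} {w : Word} (hm : w ∈ W m) (hn : w ∈ W n) : m = n := by
  rcases lt_trichotomy m n with h | h | h
  · have := hn.1 m h; rw [hm.2] at this; exact absurd this (by decide)
  · exact h
  · have := hm.1 n h; rw [hn.2] at this; exact absurd this (by decide)

theorem piece_union_saturated (i j : Fin 3) : Saturated (piece i ∪ piece j) := by
  intro n w w' hw hw' h
  rcases h with h | h
  · left
    obtain ⟨k, hk⟩ := Set.mem_iUnion.1 h
    exact Set.mem_iUnion.2 ⟨k, by rwa [← W_unique hw hk]⟩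
  · right
    obtain ⟨k, hk⟩ := Set.mem_iUnion.1 h
    exact Set.mem_iUnion.2 ⟨k, by rwa [← W_unique hw hk]⟩

theorem aFun_aFun (w : Word) : aFun (aFun w) = w := by
  funext n
  cases n with
  | zero => exact fin2_add _
  | succ n => rfl

theorem bFun_bFun (w : Word) : bFun (bFun w) = w := by
  funext n
  cases n with
  | zero => rfl
  | succ n =>
    by_cases h : w 0 = 0
    · simp [bFun, h]
    · have h1 : init (bFun w) = aFun (init w) := by funext k; simp [init, bFun, h]
      have h2 : bFun w 0 = w 0 := rfl
      change (if bFun w 0 = 0 then _ else aFun (init (bFun w)) n) = _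
      rw [h2, if_neg h, h1, aFun_aFun]
      rfl

theorem init_cFun_zero {w : Word} (h : w 0 = 0) : init (cFun w) = cFun (init w) := by
  funext k; simp [init, cFun, cLetter, h]

theorem init_cFun_one {w : Word} (h : w 0 ≠ 0) : init (cFun w) = bFun (init w) := by
  funext k; simp [init, cFun, cLetter, h]

theorem cFun_cFun (w : Word) : cFun (cFun w) = w := by
  funext n
  induction n generalizing w with
  | zero => rfl
  | succ n ih =>
    have h2 : cFun w 0 = w 0 := rfl
    change (if cFun w 0 = 0 then cFun (init (cFun w)) n else bFun (init (cFun w)) n) = _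
    by_cases h : w 0 = 0
    · rw [h2, if_pos h, init_cFun_zero h, ih]; rfl
    · rw [h2, if_neg h, init_cFun_one h, bFun_bFun]; rfl

theorem cFun_mem_W {m : ℕ} {w : Word} (hw : w ∈ W m) : cFun w ∈ W m := by
  induction m generalizing w with
  | zero => exact ⟨fun k hk => absurd hk (Nat.not_lt_zero k), hw.2⟩
  | succ m ih =>
    have h0 : w 0 = 0 := hw.1 0 (Nat.succ_pos m)
    have hi : init w ∈ W m := ⟨fun k hk => hw.1 (k + 1) (Nat.succ_lt_succ hk), hw.2⟩
    have h := ih hi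
    rw [← init_cFun_zero h0] at h
    refine ⟨fun k hk => ?_, h.2⟩
    cases k with
    | zero => exact h0
    | succ k => exact h.1 k (Nat.lt_of_succ_lt_succ hk)

theorem exists_W {w : Word} {n : ℕ} (h : ¬ ∀ k ≤ n, w k = 0) : ∃ m ≤ n, w ∈ W m := by
  classical
  push Not at h
  obtain ⟨k, hk, hk'⟩ := h
  have hex : ∃ m, w m ≠ 0 := ⟨k, hk'⟩
  exact ⟨Nat.find hex, (Nat.find_min' hex hk').trans hk,
    fun j hj => not_not.1 (Nat.find_min hex hj), fin2_ne _ (Nat.find_spec hex)⟩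

theorem cFun_zero {w : Word} {n : ℕ} (h : ∀ k ≤ n, w k = 0) : cFun w n = 0 := by
  induction n generalizing w with
  | zero => exact h 0 le_rfl
  | succ n ih =>
    change (if w 0 = 0 then cFun (init w) n else _) = _
    rw [if_pos (h 0 (Nat.zero_le _))]
    exact ih fun k hk => h (k + 1) (Nat.succ_le_succ hk)

theorem fragFun_fragFun {A : Set Word} (hA : Saturated A) (w : Word) :
    fragFun A (fragFun A w) = w := by
  by_cases hw : w ∈ A
  · have h1 : fragFun A w = cFun w := if_pos hw
    have h2 : cFun w ∈ A := by
      by_cases h0 : ∀ k, w k = 0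
      · have : cFun w = w := by
          funext n
          rw [cFun_zero fun k _ => h0 k, h0 n]
        rwa [this]
      · push Not at h0
        obtain ⟨n, hn⟩ := h0
        obtain ⟨m, -, hm⟩ := exists_W (n := n) fun h => hn (h n le_rfl)
        exact hA m _ _ hm (cFun_mem_W hm) hw
    rw [h1, fragFun, if_pos h2, cFun_cFun]
  · have h1 : fragFun A w = w := if_neg hw
    rw [h1, h1]

theorem aFun_local {n : ℕ} {w w' : Word} (h : ∀ k ≤ n, w k = w' k) : aFun w n = aFun w' n := by
  cases n with
  | zero => simp [aFun, h 0 le_rfl]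
  | succ n => exact h _ le_rfl

theorem init_local {n : ℕ} {w w' : Word} (h : ∀ k ≤ n + 1, w k = w' k) :
    ∀ k ≤ n, init w k = init w' k := fun k hk => h (k + 1) (Nat.succ_le_succ hk)

theorem bFun_local {n : ℕ} {w w' : Word} (h : ∀ k ≤ n, w k = w' k) : bFun w n = bFun w' n := by
  cases n with
  | zero => exact h 0 le_rfl
  | succ n =>
    simp [bFun, h 0 (Nat.zero_le _), h (n + 1) le_rfl, aFun_local (init_local h)]

theorem cFun_local {n : ℕ} {w w' : Word} (h : ∀ k ≤ n, w k = w' k) : cFun w n = cFun w' n := by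
  induction n generalizing w w' with
  | zero => exact h 0 le_rfl
  | succ n ih =>
    change (if w 0 = 0 then cFun (init w) n else _) = if w' 0 = 0 then cFun (init w') n else _
    rw [ih (init_local h), h 0 (Nat.zero_le _), bFun_local (init_local h)]

theorem fragFun_local {A : Set Word} (hA : Saturated A) {n : ℕ} {w w' : Word}
    (h : ∀ k ≤ n, w k = w' k) : fragFun A w n = fragFun A w' n := by
  by_cases h0 : ∀ k ≤ n, w k = 0
  · have h0' : ∀ k ≤ n, w' k = 0 := fun k hk => (h k hk).symm.trans (h0 k hk)
    have key : ∀ u : Word, (∀ k ≤ n, u k = 0) → fragFun A u n = 0 := by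
      intro u hu
      by_cases hu' : u ∈ A
      · rw [fragFun, if_pos hu', cFun_zero hu]
      · rw [fragFun, if_neg hu', hu n le_rfl]
    rw [key w h0, key w' h0']
  · obtain ⟨m, hmn, hm⟩ := exists_W h0
    have hm' : w' ∈ W m :=
      ⟨fun k hk => (h k (hk.le.trans hmn)).symm.trans (hm.1 k hk), (h m hmn).symm.trans hm.2⟩
    by_cases hw : w ∈ A
    · rw [fragFun, fragFun, if_pos hw, if_pos (hA m _ _ hm hm' hw), cFun_local h]
    · rw [fragFun, fragFun, if_neg hw, if_neg fun hw' => hw (hA m _ _ hm' hm hw'), h n le_rfl]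

theorem continuous_of_local {f : Word → Word}
    (hf : ∀ (n : ℕ) (w w' : Word), (∀ k ≤ n, w k = w' k) → f w n = f w' n) : Continuous f := by
  refine continuous_pi fun n => ?_
  refine IsLocallyConstant.continuous ?_
  rw [IsLocallyConstant.iff_eventually_eq]
  intro w
  have hev : ∀ᶠ w' in 𝓝 w, ∀ k ∈ Finset.range (n + 1), w' k = w k := by
    rw [Filter.eventually_all_finset]
    intro k _
    have := (continuous_apply k).tendsto w (IsOpen.mem_nhds (isOpen_discrete {w k}) rfl)
    exact this
  filter_upwards [hev] with w' hw'
  exact hf n _ _ fun k hk => hw' k (Finset.mem_range.2 (Nat.lt_succ_of_le hk))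

/-- An involution that respects prefixes, as a homeomorphism. -/
def ofInvolution (f : Word → Word) (hf : ∀ w, f (f w) = w)
    (hloc : ∀ (n : ℕ) (w w' : Word), (∀ k ≤ n, w k = w' k) → f w n = f w' n) : Word ≃ₜ Word where
  toFun := f
  invFun := f
  left_inv := hf
  right_inv := hf
  continuous_toFun := continuous_of_local hloc
  continuous_invFun := continuous_of_local hloc

/-- `a = σ`. -/
def a : Word ≃ₜ Word := ofInvolution aFun aFun_aFun fun _ _ _ => aFun_local

/-- `b = (1, a)`. -/
def b : Word ≃ₜ Word := ofInvolution bFun bFun_bFun fun _ _ _ => bFun_local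

/-- `c = (c, b)`. -/
def c : Word ≃ₜ Word := ofInvolution cFun cFun_cFun fun _ _ _ => cFun_local

/-- The homeomorphism that acts as `c` on `P i ∪ P j` and trivially elsewhere. -/
noncomputable def cOn (i j : Fin 3) : Word ≃ₜ Word :=
  ofInvolution (fragFun (piece i ∪ piece j)) (fragFun_fragFun (piece_union_saturated i j))
    fun _ _ _ => fragFun_local (piece_union_saturated i j)

/-- `c₀` acts as `c` on `P₀ ∪ P₁`. -/
noncomputable def c₀ : Word ≃ₜ Word := cOn 0 1

/-- `c₁` acts as `c` on `P₀ ∪ P₂`. -/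
noncomputable def c₁ : Word ≃ₜ Word := cOn 0 2

/-- `c₂` acts as `c` on `P₁ ∪ P₂`. -/
noncomputable def c₂ : Word ≃ₜ Word := cOn 1 2

theorem wreath_a : HasWreathRecursion a (Equiv.swap 0 1) ![1, 1] := by
  intro v x
  funext n
  fin_cases x <;> cases n <;> rfl

theorem wreath_b : HasWreathRecursion b 1 ![1, a] := by
  intro v x
  funext n
  fin_cases x <;> cases n <;> rfl

theorem wreath_c : HasWreathRecursion c 1 ![c, b] := by
  intro v x
  funext n
  fin_cases x <;> cases n <;> rfl

/-- The generating set `{a, b, c₀, c₁, c₂}`. -/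
def gens : Set (Word ≃ₜ Word) := {a, b, c₀, c₁, c₂}

/-- The group `G = ⟨a, b, c₀, c₁, c₂⟩`. -/
def G : Subgroup (Word ≃ₜ Word) := Subgroup.closure gens

/-- The group `⟨c₀, c₁, c₂⟩`. -/
def H : Subgroup (Word ≃ₜ Word) := Subgroup.closure {c₀, c₁, c₂}

/-- The point `0^ω`. -/
def zeroWord : Word := fun _ => 0

theorem gens_finite : gens.Finite := by
  simp [gens]

end Example

end FragK110

/-! On `W n` the map `c` flips the letter `n + 2` exactly when the letter `n + 1` is `1`. So `c`
preserves every `W n`, and `c₀`, `c₁`, `c₂` depend only on the residue of `n` mod 3. Appending `0`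
raises `n` by one and rotates the residues, which gives the wreath recursions. Two different `cGen`
multiply to the third, so `H` is a Klein four-group.

Singularities: regard words as elements of the group (ℤ/2)^ℕ. Every generator is locally a
translation, except the `cGen i` at `0^ω` (`isTranslationAt_gens`). Hence every element of `G` is
near `0^ω` an element of `H` followed by a translation (`exists_H_germ`), which determines the
germs. Along a nonloop cycle every step moves its point, so the product is locally a translation
with a fixed point, that is, trivial. Every element of `H` is trivial on some `piece j`, and these
open sets accumulate on `0^ω`.

Growth: the weight of a word is the sum of `dist` over neighbouring letters, with values in ℤ[η].
Reducing a word does not raise its weight, and the two sections of a reduced word have total weight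
at most `η` times its own (`wt_sec_add_wt_sec_le`). The second fact is an amortized count: `η` times
each `dist` splits into shares credited to the two sections, and a finite table of potentials shows
that the credit covers every letter that a section emits. The table is checked by integer interval
arithmetic.

Passing to sections until at most one letter is left describes an element by a binary tree. If `2 *
(η / 2) ^ α < 1`, concavity of `x ^ α` bounds the number of inner vertices by a constant times the
weight to the power `α` (`exists_portrait`). The number of trees with `n` inner vertices is
exponential in `n` (Catalan numbers), and the weight is linear in the length, so the growth is at
most `exp (R ^ α)` up to rescaling `R`. -/

namespace FragK110

/-! ### Wreath recursions and the Klein four-group `H` -/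

section Basics

theorem mem_piece_iff {w : Word} {n : ℕ} (hw : w ∈ W n) (j : Fin 3) :
    w ∈ piece j ↔ n % 3 = j := by
  constructor
  · intro h
    obtain ⟨k, hk⟩ := Set.mem_iUnion.1 h
    have := W_unique hw hk
    have := j.2
    omega
  · intro h
    refine Set.mem_iUnion.2 ⟨n / 3, ?_⟩
    rwa [← h, Nat.div_add_mod]

theorem zeroWord_notMem_W (n : ℕ) : zeroWord ∉ W n := fun h => zero_ne_one (α := Fin 2) h.2

theorem zeroWord_notMem_piece (j : Fin 3) : zeroWord ∉ piece j := fun h => by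
  obtain ⟨k, hk⟩ := Set.mem_iUnion.1 h
  exact zeroWord_notMem_W _ hk

theorem eq_zeroWord_or_mem_W (w : Word) : w = zeroWord ∨ ∃ n, w ∈ W n := by
  by_cases h : ∀ k, w k = 0
  · exact Or.inl (funext h)
  · push Not at h
    obtain ⟨n, hn⟩ := h
    obtain ⟨m, -, hm⟩ := exists_W (n := n) fun h' => hn (h' n le_rfl)
    exact Or.inr ⟨m, hm⟩

theorem cOn_apply {w : Word} {n : ℕ} (hw : w ∈ W n) (i j : Fin 3) :
    cOn i j w = if n % 3 = i ∨ n % 3 = j then cFun w else w := by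
  change fragFun _ w = _
  by_cases h : w ∈ piece i ∪ piece j
  · rw [fragFun, if_pos h, if_pos]
    rwa [Set.mem_union, mem_piece_iff hw, mem_piece_iff hw] at h
  · rw [fragFun, if_neg h, if_neg]
    rwa [Set.mem_union, mem_piece_iff hw, mem_piece_iff hw] at h

theorem cOn_zeroWord (i j : Fin 3) : cOn i j zeroWord = zeroWord :=
  if_neg fun h => h.elim (zeroWord_notMem_piece i) (zeroWord_notMem_piece j)

theorem c_zeroWord : c zeroWord = zeroWord := funext fun _ => cFun_zero fun _ _ => rfl

theorem snoc_zeroWord : snoc zeroWord 0 = zeroWord := by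
  funext n; cases n <;> rfl

theorem snoc_zero_mem_W {v : Word} {n : ℕ} (hv : v ∈ W n) : snoc v 0 ∈ W (n + 1) := by
  refine ⟨fun k hk => ?_, hv.2⟩
  cases k with
  | zero => rfl
  | succ k => exact hv.1 k (by omega)

theorem snoc_one_mem_W (v : Word) : snoc v 1 ∈ W 0 := ⟨fun k hk => absurd hk (by omega), rfl⟩

theorem snoc_init (w : Word) : snoc (init w) (w 0) = w := by
  funext n; cases n <;> rfl

/-- Appending `0` sends `W n` into `W (n + 1)`, so the residues that describe the support shift by
one. -/
theorem cOn_snoc_zero {i j i' j' : Fin 3}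
    (h : ∀ n : ℕ, ((n + 1) % 3 = (i : ℕ) ∨ (n + 1) % 3 = (j : ℕ)) ↔
      (n % 3 = (i' : ℕ) ∨ n % 3 = (j' : ℕ)))
    (v : Word) : cOn i j (snoc v 0) = snoc (cOn i' j' v) 0 := by
  rcases eq_zeroWord_or_mem_W v with rfl | ⟨n, hn⟩
  · rw [snoc_zeroWord, cOn_zeroWord, cOn_zeroWord, snoc_zeroWord]
  · rw [cOn_apply (snoc_zero_mem_W hn), cOn_apply hn]
    by_cases h' : n % 3 = (i' : ℕ) ∨ n % 3 = (j' : ℕ)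
    · rw [if_pos h', if_pos ((h n).2 h')]
      exact wreath_c v 0
    · rw [if_neg h', if_neg fun hn => h' ((h n).1 hn)]

theorem cOn_snoc_one (i j : Fin 3) (v : Word) :
    cOn i j (snoc v 1) = snoc (if i = 0 ∨ j = 0 then bFun v else v) 1 := by
  rw [cOn_apply (snoc_one_mem_W v)]
  have h : (0 % 3 = (i : ℕ) ∨ 0 % 3 = (j : ℕ)) ↔ (i = 0 ∨ j = 0) := by
    rw [Fin.ext_iff, Fin.ext_iff, Fin.val_zero]
    omega
  simp only [h]
  split_ifs
  · exact wreath_c v 1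
  · rfl

theorem wreath_c₀ : HasWreathRecursion c₀ 1 ![c₁, b] := by
  intro v x
  fin_cases x
  · exact cOn_snoc_zero (by simp; omega) v
  · exact (cOn_snoc_one 0 1 v).trans (by simp; rfl)

theorem wreath_c₁ : HasWreathRecursion c₁ 1 ![c₂, b] := by
  intro v x
  fin_cases x
  · exact cOn_snoc_zero (by simp; omega) v
  · exact (cOn_snoc_one 0 2 v).trans (by simp; rfl)

theorem wreath_c₂ : HasWreathRecursion c₂ 1 ![c₀, 1] := by
  intro v x
  fin_cases x
  · exact cOn_snoc_zero (by simp; omega) v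
  · exact (cOn_snoc_one 1 2 v).trans (by simp)

theorem a_mul_a : a * a = 1 := Homeomorph.ext aFun_aFun

theorem b_mul_b : b * b = 1 := Homeomorph.ext bFun_bFun

theorem c_mul_c : c * c = 1 := Homeomorph.ext cFun_cFun

/-- As `c` is an involution preserving each `W n`, the product acts as `c` on the symmetric
difference of the two unions of pieces; `h` says that this is the third union. -/
theorem cOn_mul_cOn (i j i' j' k l : Fin 3)
    (h : ∀ n : Fin 3, ((n = k ∨ n = l) ↔ ¬((n = i ∨ n = j) ↔ (n = i' ∨ n = j')))) :
    cOn i j * cOn i' j' = cOn k l := by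
  ext1 w
  rw [Homeomorph.mul_apply]
  rcases eq_zeroWord_or_mem_W w with rfl | ⟨n, hn⟩
  · simp only [cOn_zeroWord]
  · have hm : ∀ m : Fin 3, n % 3 = (m : ℕ) ↔ (⟨n % 3, Nat.mod_lt _ (by omega)⟩ : Fin 3) = m :=
      fun m => by rw [Fin.ext_iff]
    have hn' : cFun w ∈ W n := cFun_mem_W hn
    have h' := h ⟨n % 3, Nat.mod_lt _ (by omega)⟩
    rw [← hm, ← hm, ← hm, ← hm, ← hm, ← hm] at h'
    rw [cOn_apply hn, cOn_apply hn]
    by_cases h1 : n % 3 = (i' : ℕ) ∨ n % 3 = (j' : ℕ)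
    · rw [if_pos h1, cOn_apply hn']
      by_cases h2 : n % 3 = (i : ℕ) ∨ n % 3 = (j : ℕ)
      · rw [if_pos h2, cFun_cFun, if_neg (by tauto)]
      · rw [if_neg h2, if_pos (by tauto)]
    · rw [if_neg h1, cOn_apply hn]
      by_cases h2 : n % 3 = (i : ℕ) ∨ n % 3 = (j : ℕ)
      · rw [if_pos h2, if_pos (by tauto)]
      · rw [if_neg h2, if_neg (by tauto)]

theorem cOn_mul_self (i j : Fin 3) : cOn i j * cOn i j = 1 :=
  Homeomorph.ext (fragFun_fragFun (piece_union_saturated i j))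

/-- The generator `c₀`, `c₁` or `c₂`, by its index. -/
noncomputable def cGen : Fin 3 → (Word ≃ₜ Word) := ![c₀, c₁, c₂]

theorem cGen_mul_self (i : Fin 3) : cGen i * cGen i = 1 := by
  fin_cases i <;> exact cOn_mul_self _ _

/-- The third index. -/
def third (i j : Fin 3) : Fin 3 := -(i + j)

theorem cGen_mul_cGen {i j : Fin 3} (hij : i ≠ j) : cGen i * cGen j = cGen (third i j) := by
  fin_cases i <;> fin_cases j <;> first
    | exact absurd rfl hij
    | exact cOn_mul_cOn _ _ _ _ _ _ (by decide)

theorem cGen_eq_cOn (i : Fin 3) : ∃ k l, cGen i = cOn k l := by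
  fin_cases i <;> exact ⟨_, _, rfl⟩

theorem cGen_zeroWord (i : Fin 3) : cGen i zeroWord = zeroWord := by
  obtain ⟨k, l, h⟩ := cGen_eq_cOn i
  rw [h, cOn_zeroWord]

theorem cGen_apply {w : Word} {n : ℕ} (hw : w ∈ W n) (i : Fin 3) :
    cGen i w = if n % 3 = (2 - i : Fin 3) then w else cFun w := by
  have hn : n % 3 = 0 ∨ n % 3 = 1 ∨ n % 3 = 2 := by omega
  fin_cases i <;> refine (cOn_apply hw _ _).trans ?_ <;>
    rcases hn with hn | hn | hn <;> simp [hn]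

theorem mem_H_iff {h : Word ≃ₜ Word} : h ∈ H ↔ h = 1 ∨ ∃ i, h = cGen i := by
  constructor
  · intro hh
    induction hh using Subgroup.closure_induction with
    | mem x hx =>
      right
      rcases hx with rfl | rfl | rfl
      exacts [⟨0, rfl⟩, ⟨1, rfl⟩, ⟨2, rfl⟩]
    | one => exact Or.inl rfl
    | mul x y _ _ hx hy =>
      rcases hx with rfl | ⟨i, rfl⟩
      · rwa [one_mul]
      rcases hy with rfl | ⟨j, rfl⟩
      · rw [mul_one]; exact Or.inr ⟨i, rfl⟩
      by_cases hij : i = j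
      · subst hij; exact Or.inl (cGen_mul_self i)
      · exact Or.inr ⟨_, cGen_mul_cGen hij⟩
    | inv x _ hx =>
      rcases hx with rfl | ⟨i, rfl⟩
      · left; exact inv_one
      · exact Or.inr ⟨i, inv_eq_of_mul_eq_one_left (cGen_mul_self i)⟩
  · rintro (rfl | ⟨i, rfl⟩)
    · exact H.one_mem
    · refine Subgroup.subset_closure ?_
      fin_cases i
      exacts [Or.inl rfl, Or.inr (Or.inl rfl), Or.inr (Or.inr rfl)]

/-- Unwinding `c = (c, b)` through the `n` zeros leads to `b`, and `b = (1, a)` then reads the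
letter `n + 1` to decide whether `a` flips the next one. -/
theorem cFun_apply {w : Word} {n : ℕ} (hw : w ∈ W n) (k : ℕ) :
    cFun w k = if k = n + 2 ∧ w (n + 1) = 1 then w k + 1 else w k := by
  induction n generalizing w k with
  | zero =>
    cases k with
    | zero => simp [cFun, cLetter]
    | succ k =>
      have h1 : init (cFun w) = bFun (init w) := init_cFun_one (by rw [hw.2]; decide)
      have h2 : cFun w (k + 1) = bFun (init w) k := congrFun h1 k
      rw [h2]
      match k with
      | 0 => simp [bFun, init]
      | 1 =>
        by_cases h : w 1 = 0
        · simp [bFun, init, h]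
        · have h' : w 1 = 1 := fin2_ne _ h
          simp [bFun, init, h', aFun]
      | k + 2 => simp [bFun, init, aFun]
  | succ n ih =>
    have h0 : w 0 = 0 := hw.1 0 (Nat.succ_pos n)
    have hi : init w ∈ W n := ⟨fun k hk => hw.1 (k + 1) (Nat.succ_lt_succ hk), hw.2⟩
    cases k with
    | zero => simp [cFun, cLetter]
    | succ k =>
      have h1 : cFun w (k + 1) = cFun (init w) k := congrFun (init_cFun_zero h0) k
      rw [h1, ih hi]
      exact if_congr (by simp [init]) rfl rfl

/-- The word with ones exactly in places `n` and `n + 1`. -/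
def testWord (n : ℕ) : Word := fun k => if k = n ∨ k = n + 1 then 1 else 0

theorem testWord_mem_W (n : ℕ) : testWord n ∈ W n :=
  ⟨fun k hk => if_neg (by omega), if_pos (Or.inl rfl)⟩

theorem cFun_testWord_ne (n : ℕ) : cFun (testWord n) ≠ testWord n := fun h => by
  have h1 := congrFun h (n + 2)
  rw [cFun_apply (testWord_mem_W n)] at h1
  simp [testWord] at h1

theorem tendsto_testWord : Tendsto testWord atTop (𝓝 zeroWord) := by
  rw [tendsto_pi_nhds]
  intro k
  refine tendsto_const_nhds.congr' ?_
  filter_upwards [eventually_gt_atTop k] with n hn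
  exact (if_neg (by omega)).symm

theorem exists_testWord {P : Word → Prop} (h : ∀ᶠ x in 𝓝 zeroWord, P x) :
    ∃ N, ∀ n ≥ N, P (testWord n) :=
  eventually_atTop.1 (tendsto_testWord.eventually h)

theorem cGen_testWord (n : ℕ) (i : Fin 3) :
    cGen i (testWord n) = testWord n ↔ n % 3 = (2 - i : Fin 3) := by
  rw [cGen_apply (testWord_mem_W n)]
  split_ifs with h
  · simp [h]
  · simp [h, cFun_testWord_ne]

/-- The test words converge to `0^ω`, and `cGen i` fixes only those with index in one residue class
mod 3. Hence no `cGen i` has trivial germ. -/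
theorem H_eq_of_germ_eq {h h' : Word ≃ₜ Word} (hh : h ∈ H) (hh' : h' ∈ H)
    (he : ∀ᶠ x in 𝓝 zeroWord, h x = h' x) : h = h' := by
  have key : ∀ g ∈ H, (∀ᶠ x in 𝓝 zeroWord, g x = x) → g = 1 := by
    intro g hg he
    rcases mem_H_iff.1 hg with rfl | ⟨i, rfl⟩
    · rfl
    · obtain ⟨N, hN⟩ := exists_testWord he
      have h1 := (cGen_testWord _ i).1 (hN (3 * N) (by omega))
      have h2 := (cGen_testWord _ i).1 (hN (3 * N + 1) (by omega))
      omega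
  have : h'⁻¹ * h = 1 := by
    refine key _ (H.mul_mem (H.inv_mem hh') hh) ?_
    filter_upwards [he] with x hx
    rw [Homeomorph.mul_apply, hx, Homeomorph.inv_apply, Homeomorph.symm_apply_apply]
  exact (inv_mul_eq_one.1 this).symm

theorem cGen_ne_one (i : Fin 3) : cGen i ≠ 1 := fun h => by
  have h1 : ∀ n, n % 3 = ((2 - i : Fin 3) : ℕ) := fun n => (cGen_testWord n i).1 (by rw [h]; rfl)
  have := h1 0
  have := h1 1
  omega

theorem cGen_injective : Function.Injective cGen := by
  intro i j hij
  by_contra hne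
  have := cGen_mul_cGen hne
  rw [hij, cGen_mul_self] at this
  exact cGen_ne_one _ this.symm

theorem H_carrier : (H : Set (Word ≃ₜ Word)) = Set.range (fun o : Option (Fin 3) => o.elim 1 cGen) := by
  ext h
  rw [SetLike.mem_coe, mem_H_iff]
  constructor
  · rintro (rfl | ⟨i, rfl⟩)
    exacts [⟨none, rfl⟩, ⟨some i, rfl⟩]
  · rintro ⟨_ | i, rfl⟩
    exacts [Or.inl rfl, Or.inr ⟨i, rfl⟩]

theorem H_finite : Finite H := by
  have : (H : Set (Word ≃ₜ Word)).Finite := by rw [H_carrier]; exact Set.finite_range _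
  exact this

theorem H_isKleinFour : IsKleinFour H where
  card_four := by
    have hinj : Function.Injective (fun o : Option (Fin 3) => o.elim 1 cGen) := by
      rintro (_ | i) (_ | j) h
      · rfl
      · exact absurd h.symm (cGen_ne_one j)
      · exact absurd h (cGen_ne_one i)
      · exact congrArg some (cGen_injective h)
    have : Nat.card (H : Set (Word ≃ₜ Word)) = 4 := by
      rw [H_carrier, Nat.card_range_of_injective hinj]
      simp
    exact this
  exponent_two := by
    have hsq : ∀ h : H, h ^ 2 = 1 := by
      rintro ⟨h, hh⟩
      refine Subtype.ext ?_
      rw [Subgroup.coe_pow, pow_two]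
      rcases mem_H_iff.1 hh with rfl | ⟨i, rfl⟩
      · exact one_mul 1
      · exact cGen_mul_self i
    refine ((Nat.dvd_prime Nat.prime_two).1 (Monoid.exponent_dvd_of_forall_pow_eq_one hsq)).resolve_left ?_
    intro h1
    have hs := Monoid.exp_eq_one_iff.1 h1
    have hm : cGen 0 ∈ H := mem_H_iff.2 (Or.inr ⟨0, rfl⟩)
    have := Subsingleton.elim (⟨_, hm⟩ : H) 1
    exact cGen_ne_one 0 (congrArg Subtype.val this)

end Basics

/-! ### Fragmentations of `a`, `b` and `c` -/

section Fragmentation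

theorem eventually_eq_prefix (p : Word) (n : ℕ) : ∀ᶠ y in 𝓝 p, ∀ k ≤ n, y k = p k := by
  have hev : ∀ᶠ y in 𝓝 p, ∀ k ∈ Finset.range (n + 1), y k = p k := by
    rw [Filter.eventually_all_finset]
    intro k _
    exact (continuous_apply k).tendsto p (IsOpen.mem_nhds (isOpen_discrete {p k}) rfl)
  filter_upwards [hev] with y hy k hk
  exact hy k (Finset.mem_range.2 (Nat.lt_succ_of_le hk))

theorem isOpen_W (n : ℕ) : IsOpen (W n) := by
  rw [isOpen_iff_mem_nhds]
  intro p hp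
  filter_upwards [eventually_eq_prefix p n] with y hy
  exact ⟨fun k hk => (hy k hk.le).trans (hp.1 k hk), (hy n le_rfl).trans hp.2⟩

theorem isOpen_piece (j : Fin 3) : IsOpen (piece j) := isOpen_iUnion fun _ => isOpen_W _

theorem cFun_mem_piece {j : Fin 3} {w : Word} (hw : w ∈ piece j) : cFun w ∈ piece j := by
  obtain ⟨k, hk⟩ := Set.mem_iUnion.1 hw
  exact Set.mem_iUnion.2 ⟨k, cFun_mem_W hk⟩

theorem isOpen_support (h : Word ≃ₜ Word) : IsOpen {w | h w ≠ w} :=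
  isOpen_ne_fun h.continuous continuous_id

theorem zpow_eq_one_or_self {Γ : Type*} [Group Γ] {h : Γ} (hh : h * h = 1) (k : ℤ) :
    h ^ k = 1 ∨ h ^ k = h := by
  obtain ⟨m, rfl | rfl⟩ := Int.even_or_odd' k
  · left; rw [zpow_mul, zpow_two, hh, one_zpow]
  · right; rw [zpow_add, zpow_mul, zpow_two, hh, one_zpow, one_mul, zpow_one]

theorem isOfFinOrder_of_mul_self {Γ : Type*} [Group Γ] {h : Γ} (hh : h * h = 1) :
    IsOfFinOrder h :=
  isOfFinOrder_iff_pow_eq_one.2 ⟨2, two_pos, by rw [pow_two, hh]⟩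

theorem involution_apply {h : Word ≃ₜ Word} (hh : h * h = 1) (x : Word) : h (h x) = x := by
  rw [← Homeomorph.mul_apply, hh]; rfl

theorem image_eq_of_involution {h : Word ≃ₜ Word} (hh : h * h = 1) {P : Set Word}
    (hP : ∀ x ∈ P, h x ∈ P) : h '' P = P := by
  refine Set.Subset.antisymm (Set.image_subset_iff.2 hP) fun x hx => ⟨h x, hP x hx, ?_⟩
  exact involution_apply hh x

theorem isFragmentation_zpowers {h : Word ≃ₜ Word} (hh : h * h = 1) {w : Word} (hw : h w ≠ w) :
    IsFragmentation (Subgroup.zpowers h) h {{w | h w ≠ w}} where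
  finite_order := isOfFinOrder_of_mul_self hh
  finite_pieces := Set.finite_singleton _
  nonempty_pieces := by rintro P rfl; exact ⟨w, hw⟩
  disjoint_pieces := Set.pairwiseDisjoint_singleton _ _
  cover := Set.sUnion_singleton _
  open_pieces := by rintro P rfl; exact isOpen_support h
  invariant_pieces := by
    rintro P rfl
    exact image_eq_of_involution hh fun x hx hx' => hx (h.injective hx')
  finite_group := isOfFinOrder_of_mul_self hh |>.finite_zpowers
  local_power := by
    rintro g ⟨k, rfl⟩ P -
    exact ⟨k, fun _ _ => rfl⟩
  fix := by
    rintro g ⟨k, rfl⟩ x hx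
    rcases zpow_eq_one_or_self hh k with hk | hk
    · simp only [hk]; rfl
    · simpa only [hk] using hx
  onto_piece := fun P _ k => ⟨h ^ k, ⟨k, rfl⟩, fun _ _ => rfl⟩

theorem cGen_eqOn_piece (i j : Fin 3) :
    Set.EqOn (cGen i) (if j = 2 - i then 1 else c : Word ≃ₜ Word) (piece j) := by
  intro w hw
  obtain ⟨k, hk⟩ := Set.mem_iUnion.1 hw
  have hj := (mem_piece_iff hk j).1 hw
  rw [cGen_apply hk, hj]
  by_cases h : j = 2 - i
  · rw [if_pos h, if_pos (congrArg Fin.val h)]; rfl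
  · rw [if_neg h, if_neg fun h' => h (Fin.ext h')]; rfl

theorem isFragmentation_H :
    IsFragmentation H c (Set.range fun j : Fin 3 => piece j ∩ {w | c w ≠ w}) where
  finite_order := isOfFinOrder_of_mul_self c_mul_c
  finite_pieces := Set.finite_range _
  nonempty_pieces := by
    rintro _ ⟨j, rfl⟩
    have := j.2
    exact ⟨testWord j, (mem_piece_iff (testWord_mem_W j) j).2 (by omega), cFun_testWord_ne j⟩
  disjoint_pieces := by
    rintro _ ⟨j, rfl⟩ _ ⟨j', rfl⟩ hne
    have hjj : j ≠ j' := by rintro rfl; exact hne rfl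
    refine Set.disjoint_left.2 fun w hw hw' => hjj ?_
    obtain ⟨k, hk⟩ := Set.mem_iUnion.1 hw.1
    exact Fin.ext (((mem_piece_iff hk j).1 hw.1).symm.trans ((mem_piece_iff hk j').1 hw'.1))
  cover := by
    refine Set.Subset.antisymm ?_ fun w hw => ?_
    · rintro w ⟨_, ⟨j, rfl⟩, hw⟩
      exact hw.2
    · rcases eq_zeroWord_or_mem_W w with rfl | ⟨n, hn⟩
      · exact absurd c_zeroWord hw
      · exact ⟨_, ⟨⟨n % 3, Nat.mod_lt _ (by omega)⟩, rfl⟩, (mem_piece_iff hn _).2 rfl, hw⟩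
  open_pieces := by
    rintro _ ⟨j, rfl⟩
    exact (isOpen_piece j).inter (isOpen_support c)
  invariant_pieces := by
    rintro _ ⟨j, rfl⟩
    exact image_eq_of_involution c_mul_c fun x hx =>
      ⟨cFun_mem_piece hx.1, fun hx' => hx.2 (c.injective hx')⟩
  finite_group := H_finite
  local_power := by
    rintro g hg _ ⟨j, rfl⟩
    rcases mem_H_iff.1 hg with rfl | ⟨i, rfl⟩
    · exact ⟨0, fun _ _ => by rw [zpow_zero]⟩
    · by_cases h : j = 2 - i
      · refine ⟨0, fun w hw => ?_⟩
        rw [cGen_eqOn_piece i j hw.1, if_pos h, zpow_zero]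
      · refine ⟨1, fun w hw => ?_⟩
        rw [cGen_eqOn_piece i j hw.1, if_neg h, zpow_one]
  fix := by
    intro g hg x hx
    rcases mem_H_iff.1 hg with rfl | ⟨i, rfl⟩
    · rfl
    · rcases eq_zeroWord_or_mem_W x with rfl | ⟨n, hn⟩
      · exact cGen_zeroWord i
      · rw [cGen_apply hn]
        split_ifs
        exacts [rfl, hx]
  onto_piece := by
    rintro _ ⟨j, rfl⟩ k
    rcases zpow_eq_one_or_self c_mul_c k with hk | hk
    · exact ⟨1, H.one_mem, fun w _ => by rw [hk]⟩
    -- `cGen i` is trivial only on the piece `2 - i`; for `i = 1 - j` this is `j + 1`, so `cGen i`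
    -- acts as `c` on the piece `j`.
    · refine ⟨cGen (1 - j), mem_H_iff.2 (Or.inr ⟨_, rfl⟩), fun w hw => ?_⟩
      have hj : ∀ j : Fin 3, j ≠ 2 - (1 - j) := by decide
      rw [cGen_eqOn_piece _ j hw.1, if_neg (hj j), hk]

theorem a_apply_ne (w : Word) : a w ≠ w := fun h => by
  have h0 : w 0 + 1 = w 0 := congrFun h 0
  revert h0
  generalize w 0 = x
  revert x
  decide

theorem a_ne_c : a ≠ c := fun h => a_apply_ne zeroWord (by rw [h, c_zeroWord])

theorem b_apply_ne {w : Word} (hw : w 0 = 1) : b w ≠ w := fun h => by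
  have h0 := congrFun h 1
  change (if w 0 = 0 then w 1 else w 1 + 1) = w 1 at h0
  rw [hw, if_neg (by decide)] at h0
  revert h0
  generalize w 1 = x
  revert x
  decide

theorem b_ne_c : b ≠ c := fun h => by
  have hw : snoc zeroWord 1 ∈ W 0 := snoc_one_mem_W _
  refine b_apply_ne (w := snoc zeroWord 1) rfl ?_
  rw [h]
  funext k
  refine (cFun_apply hw k).trans (if_neg ?_)
  rintro ⟨-, h1⟩
  exact zero_ne_one (α := Fin 2) h1

theorem mem_gens_iff {s : Word ≃ₜ Word} : s ∈ gens ↔ s = a ∨ s = b ∨ ∃ i, s = cGen i := by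
  constructor
  · rintro (rfl | rfl | rfl | rfl | rfl)
    exacts [Or.inl rfl, Or.inr (Or.inl rfl), Or.inr (Or.inr ⟨0, rfl⟩), Or.inr (Or.inr ⟨1, rfl⟩),
      Or.inr (Or.inr ⟨2, rfl⟩)]
  · rintro (rfl | rfl | ⟨i, rfl⟩)
    · exact Or.inl rfl
    · exact Or.inr (Or.inl rfl)
    · fin_cases i
      exacts [Or.inr (Or.inr (Or.inl rfl)), Or.inr (Or.inr (Or.inr (Or.inl rfl))),
        Or.inr (Or.inr (Or.inr (Or.inr rfl)))]

theorem isFragmentationGroup_G : IsFragmentationGroup {a, b, c} G := by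
  classical
  refine ⟨fun s => if s = c then H else Subgroup.zpowers s, ?_, ?_⟩
  · rintro s (rfl | rfl | rfl) <;> beta_reduce
    · rw [if_neg a_ne_c]
      exact ⟨_, isFragmentation_zpowers a_mul_a (a_apply_ne zeroWord)⟩
    · rw [if_neg b_ne_c]
      exact ⟨_, isFragmentation_zpowers b_mul_b (b_apply_ne (w := snoc zeroWord 1) rfl)⟩
    · rw [if_pos rfl]
      exact ⟨_, isFragmentation_H⟩
  · rw [iSup_insert, iSup_insert, iSup_singleton, if_neg a_ne_c, if_neg b_ne_c, if_pos rfl,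
      Subgroup.zpowers_eq_closure, Subgroup.zpowers_eq_closure, G, H, ← Subgroup.closure_union,
      ← Subgroup.closure_union]
    rfl

end Fragmentation

/-! ### Germs at `0^ω` and the purely non-Hausdorff singularity -/

section Singularity

theorem gens_mul_self {s : Word ≃ₜ Word} (hs : s ∈ gens) : s * s = 1 := by
  rcases mem_gens_iff.1 hs with rfl | rfl | ⟨i, rfl⟩
  exacts [a_mul_a, b_mul_b, cGen_mul_self i]

theorem gens_inv {s : Word ≃ₜ Word} (hs : s ∈ gens) : s⁻¹ = s :=
  inv_eq_of_mul_eq_one_left (gens_mul_self hs)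

theorem mem_gens_of_inv {s : Word ≃ₜ Word} (hs : s ∈ gens ∨ s⁻¹ ∈ gens) : s ∈ gens := by
  rcases hs with hs | hs
  · exact hs
  · have := gens_inv hs
    rw [inv_inv] at this
    rwa [this]

/-- `g` acts near `p` as the translation that takes `p` to `g p`. -/
def IsTranslationAt (g : Word ≃ₜ Word) (p : Word) : Prop := ∀ᶠ y in 𝓝 p, g y = y + (g p - p)

theorem IsTranslationAt.of_add {g : Word ≃ₜ Word} {p e : Word} (h : ∀ᶠ y in 𝓝 p, g y = y + e) :
    IsTranslationAt g p := by
  have hp : g p = p + e := h.self_of_nhds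
  filter_upwards [h] with y hy
  rw [hy, hp, add_sub_cancel_left]

theorem IsTranslationAt.mul {g h : Word ≃ₜ Word} {p : Word} (hg : IsTranslationAt g (h p))
    (hh : IsTranslationAt h p) : IsTranslationAt (g * h) p := by
  filter_upwards [hh, (h.continuous.tendsto p).eventually hg] with y hy hy'
  rw [Homeomorph.mul_apply, Homeomorph.mul_apply, hy', hy]
  abel

theorem isTranslationAt_a (p : Word) : IsTranslationAt a p := by
  refine .of_add (e := Pi.single 0 1) (Eventually.of_forall fun y => ?_)
  funext n
  cases n with
  | zero => rfl
  | succ n => exact (add_zero _).symm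

theorem isTranslationAt_one (p : Word) : IsTranslationAt 1 p :=
  .of_add (e := 0) (Eventually.of_forall fun y => (add_zero y).symm)

theorem isTranslationAt_b (p : Word) : IsTranslationAt b p := by
  refine .of_add (e := if p 0 = 0 then 0 else Pi.single 1 1) ?_
  filter_upwards [eventually_eq_prefix p 0] with y hy
  funext n
  change bFun y n = _
  by_cases h : p 0 = 0
  · have h' : y 0 = 0 := (hy 0 le_rfl).trans h
    rw [if_pos h, add_zero]
    cases n <;> simp [bFun, h']
  · have h' : y 0 ≠ 0 := by rwa [hy 0 le_rfl]
    rw [if_neg h]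
    match n with
    | 0 => simp [bFun]
    | 1 => simp [bFun, h', aFun, init]
    | n + 2 => simp [bFun, h', aFun, init]

theorem isTranslationAt_c {p : Word} (hp : p ≠ zeroWord) : IsTranslationAt c p := by
  obtain ⟨n, hn⟩ := (eq_zeroWord_or_mem_W p).resolve_left hp
  refine .of_add (e := if p (n + 1) = 1 then Pi.single (n + 2) 1 else 0) ?_
  filter_upwards [eventually_eq_prefix p (n + 1), (isOpen_W n).mem_nhds hn] with y hy hyn
  funext k
  refine (cFun_apply hyn k).trans ?_
  rw [hy (n + 1) le_rfl]
  by_cases h : p (n + 1) = 1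
  · rw [if_pos h, Pi.add_apply]
    by_cases hk : k = n + 2
    · subst hk; rw [if_pos ⟨rfl, h⟩, Pi.single_eq_same]
    · rw [if_neg fun h' => hk h'.1, Pi.single_eq_of_ne hk, add_zero]
  · rw [if_neg h, if_neg fun h' => h h'.2, add_zero]

theorem isTranslationAt_cGen {p : Word} (hp : p ≠ zeroWord) (i : Fin 3) :
    IsTranslationAt (cGen i) p := by
  obtain ⟨n, hn⟩ := (eq_zeroWord_or_mem_W p).resolve_left hp
  have hev : ∀ᶠ y in 𝓝 p, y ∈ W n := (isOpen_W n).mem_nhds hn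
  by_cases h : n % 3 = (2 - i : Fin 3)
  · refine .of_add (e := 0) ?_
    filter_upwards [hev] with y hy
    rw [cGen_apply hy, if_pos h, add_zero]
  · have he := isTranslationAt_c hp
    refine .of_add (e := c p - p) ?_
    filter_upwards [hev, he] with y hy hy'
    rw [cGen_apply hy, if_neg h]
    exact hy'

/-- Away from `0^ω` the flipped letter is determined by a finite prefix. At `0^ω` only the `cGen i`
can fail to be translations, and they fix that point. -/
theorem isTranslationAt_gens {s : Word ≃ₜ Word} (hs : s ∈ gens) {p : Word}
    (hp : p ≠ zeroWord ∨ s p ≠ p) : IsTranslationAt s p := by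
  rcases mem_gens_iff.1 hs with rfl | rfl | ⟨i, rfl⟩
  · exact isTranslationAt_a p
  · exact isTranslationAt_b p
  · refine isTranslationAt_cGen ?_ i
    rintro rfl
    rcases hp with hp | hp
    · exact hp rfl
    · exact hp (cGen_zeroWord i)

/-- Induction on left multiplication by generators: a generator that is a translation at `g
zeroWord` changes only the translation part; otherwise it is some `cGen i` applied at `0^ω` itself,
and it is absorbed into `h`. -/
theorem exists_H_germ {g : Word ≃ₜ Word} (hg : g ∈ G) :
    ∃ h ∈ H, ∀ᶠ x in 𝓝 zeroWord, g x = h x + g zeroWord := by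
  have hz : ∀ x : Word, x + zeroWord = x := add_zero
  have hH : ∀ h ∈ H, h zeroWord = zeroWord := by
    intro h hh
    rcases mem_H_iff.1 hh with rfl | ⟨i, rfl⟩
    exacts [rfl, cGen_zeroWord i]
  have step : ∀ s ∈ gens, ∀ g : Word ≃ₜ Word,
      (∃ h ∈ H, ∀ᶠ x in 𝓝 zeroWord, g x = h x + g zeroWord) →
      ∃ h ∈ H, ∀ᶠ x in 𝓝 zeroWord, (s * g) x = h x + (s * g) zeroWord := by
    rintro s hs g ⟨h, hh, he⟩
    by_cases ht : IsTranslationAt s (g zeroWord)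
    · refine ⟨h, hh, ?_⟩
      filter_upwards [he, (g.continuous.tendsto zeroWord).eventually ht] with x hx hx'
      rw [Homeomorph.mul_apply, Homeomorph.mul_apply, hx', hx]
      abel
    · have h0 : g zeroWord = zeroWord := by
        by_contra h0
        exact ht (isTranslationAt_gens hs (Or.inl h0))
      rcases mem_gens_iff.1 hs with rfl | rfl | ⟨i, rfl⟩
      · exact absurd (isTranslationAt_a _) ht
      · exact absurd (isTranslationAt_b _) ht
      · refine ⟨cGen i * h, H.mul_mem (mem_H_iff.2 (Or.inr ⟨i, rfl⟩)) hh, ?_⟩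
        filter_upwards [he] with x hx
        rw [Homeomorph.mul_apply, Homeomorph.mul_apply, Homeomorph.mul_apply, hx, h0,
          cGen_zeroWord, hz, hz]
  refine Subgroup.closure_induction_left (p := fun g _ => ∃ h ∈ H, ∀ᶠ x in 𝓝 zeroWord,
    g x = h x + g zeroWord) ⟨1, H.one_mem, Eventually.of_forall fun x => (hz x).symm⟩
    (fun s hs g _ ih => step s hs g ih) (fun s hs g _ ih => ?_) hg
  rw [gens_inv hs]
  exact step s hs g ih

theorem H_fix {h : Word ≃ₜ Word} (hh : h ∈ H) : h zeroWord = zeroWord :=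
  isFragmentation_H.fix h hh _ c_zeroWord

theorem H_le_G : H ≤ G := Subgroup.closure_mono (by
  rintro s (rfl | rfl | rfl)
  exacts [Or.inr (Or.inr (Or.inl rfl)), Or.inr (Or.inr (Or.inr (Or.inl rfl))),
        Or.inr (Or.inr (Or.inr (Or.inr rfl)))])

theorem existsUnique_H_germ {g : Word ≃ₜ Word} (hg : g ∈ G) (h0 : g zeroWord = zeroWord) :
    ∃! h : Word ≃ₜ Word, h ∈ H ∧ ∀ᶠ x in 𝓝 zeroWord, g x = h x := by
  obtain ⟨h, hh, he⟩ := exists_H_germ hg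
  have he' : ∀ᶠ x in 𝓝 zeroWord, g x = h x := by
    filter_upwards [he] with x hx
    rw [hx, h0]
    exact add_zero _
  refine ⟨h, ⟨hh, he'⟩, ?_⟩
  rintro h' ⟨hh', he''⟩
  refine H_eq_of_germ_eq hh' hh ?_
  filter_upwards [he', he''] with x hx hx'
  rw [← hx, hx']

theorem H_le_pointStab : H ≤ pointStab G zeroWord := fun _ hh => ⟨H_le_G hh, H_fix hh⟩

theorem germGroup_equiv : Nonempty (H ≃* GermGroup G zeroWord) := by
  let φ : H →* GermGroup G zeroWord :=
    (QuotientGroup.mk' _).comp (Subgroup.inclusion H_le_pointStab)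
  refine ⟨MulEquiv.ofBijective φ ⟨?_, ?_⟩⟩
  · rintro ⟨h, hh⟩ ⟨h', hh'⟩ heq
    have h1 := QuotientGroup.eq.1 heq
    rw [Subgroup.mem_subgroupOf] at h1
    refine Subtype.ext (H_eq_of_germ_eq hh hh' ?_)
    filter_upwards [h1.2] with x hx
    change h.symm (h' x) = x at hx
    rw [← hx, h.apply_symm_apply, hx]
  · intro q
    obtain ⟨⟨g, hg⟩, rfl⟩ := QuotientGroup.mk_surjective q
    obtain ⟨h, ⟨hh, he⟩, -⟩ := existsUnique_H_germ hg.1 hg.2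
    refine ⟨⟨h, hh⟩, QuotientGroup.eq.2 ?_⟩
    rw [Subgroup.mem_subgroupOf]
    refine ⟨G.mul_mem (G.inv_mem (H_le_G hh)) hg.1, ?_⟩
    filter_upwards [he] with x hx
    change h.symm (g x) = x
    rw [hx, h.symm_apply_apply]

theorem isSingularOfGenerators_iff {p : Word} : IsSingularOfGenerators gens p ↔ p = zeroWord := by
  constructor
  · rintro ⟨s, hs, hsp, hne⟩
    by_contra hp
    refine hne ?_
    filter_upwards [isTranslationAt_gens hs (Or.inl hp)] with y hy
    rw [hy, hsp, sub_self, add_zero]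
  · rintro rfl
    refine ⟨cGen 0, mem_gens_iff.2 (Or.inr (Or.inr ⟨0, rfl⟩)), cGen_zeroWord 0, fun h => ?_⟩
    exact cGen_ne_one 0 (H_eq_of_germ_eq (mem_H_iff.2 (Or.inr ⟨0, rfl⟩)) H.one_mem h)

/-- A generator that moves the current point is a translation there, even if that point is `0^ω`. -/
theorem isTranslationAt_prod {ζ : Word} (l : List (Word ≃ₜ Word)) (hl : ∀ s ∈ l, s ∈ gens)
    (hne : ∀ i < l.length, (l.drop i).prod ζ ≠ (l.drop (i + 1)).prod ζ) :
    IsTranslationAt l.prod ζ := by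
  induction l with
  | nil => exact isTranslationAt_one ζ
  | cons s l ih =>
    rw [List.prod_cons]
    refine .mul (isTranslationAt_gens (hl s List.mem_cons_self) (Or.inr ?_))
      (ih (fun t ht => hl t (List.mem_cons_of_mem _ ht)) fun i hi => ?_)
    · simpa using hne 0 (by simp)
    · simpa using hne (i + 1) (by simpa using hi)

theorem isNonloopCycle_prod {ζ : Word} {l : List (Word ≃ₜ Word)} (h : IsNonloopCycle gens ζ l) :
    ∀ᶠ x in 𝓝 ζ, l.prod x = x := by
  obtain ⟨h2, hl, hinj, hprod⟩ := h
  have ht : IsTranslationAt l.prod ζ := by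
    refine isTranslationAt_prod l (fun s hs => mem_gens_of_inv (hl s hs)) fun i hi heq => ?_
    -- Injectivity covers the indices from `1` to the length. Index `0` gives `ζ` again, as does the
    -- full length, so a stationary last step would force length `1`.
    rcases Nat.eq_zero_or_pos i with rfl | hpos
    · have h1 : (l.drop 1).prod ζ = (l.drop l.length).prod ζ := by
        rw [← heq, List.drop_zero, hprod, List.drop_length]; rfl
      have := hinj (Set.mem_Icc.2 ⟨le_rfl, by omega⟩) (Set.mem_Icc.2 ⟨by omega, le_rfl⟩) h1
      omega
    · have := hinj (Set.mem_Icc.2 ⟨hpos, hi.le⟩) (Set.mem_Icc.2 ⟨by omega, hi⟩) heq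
      omega
  filter_upwards [ht] with y hy
  rw [hy, hprod, sub_self, add_zero]

theorem isGermDefining_zeroWord : IsGermDefining gens zeroWord := by
  refine ⟨?_, fun g _ => isSingularOfGenerators_iff, fun g _ l hl => isNonloopCycle_prod hl⟩
  obtain ⟨e⟩ := germGroup_equiv
  have : Nontrivial H :=
    ⟨⟨⟨cGen 0, mem_H_iff.2 (Or.inr ⟨0, rfl⟩)⟩, 1, fun h => cGen_ne_one 0 (congrArg Subtype.val h)⟩⟩
  exact e.symm.toEquiv.nontrivial

theorem accPt_interior_fixed {g : Word ≃ₜ Word} (hg : g ∈ G) (h0 : g zeroWord = zeroWord) :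
    AccPt zeroWord (𝓟 (interior {x | g x = x})) := by
  obtain ⟨h, ⟨hh, he⟩, -⟩ := existsUnique_H_germ hg h0
  obtain ⟨j, hj⟩ : ∃ j : Fin 3, ∀ x ∈ piece j, h x = x := by
    rcases mem_H_iff.1 hh with rfl | ⟨i, rfl⟩
    · exact ⟨0, fun _ _ => rfl⟩
    · refine ⟨2 - i, fun x hx => ?_⟩
      rw [cGen_eqOn_piece i _ hx, if_pos rfl]; rfl
  rw [accPt_iff_nhds]
  intro U hU
  obtain ⟨V, hV, hVo, hVm⟩ := mem_nhds_iff.1 (Filter.inter_mem hU he)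
  obtain ⟨N, hN⟩ := exists_testWord (hVo.mem_nhds hVm)
  have hmem : testWord (3 * N + j) ∈ piece j :=
    (mem_piece_iff (testWord_mem_W _) j).2 (by have := j.2; omega)
  have hVt : testWord (3 * N + j) ∈ V := hN _ (by omega)
  refine ⟨testWord (3 * N + j), ⟨(hV hVt).1, ?_⟩, fun h => zeroWord_notMem_piece j (h ▸ hmem)⟩
  refine mem_interior.2 ⟨V ∩ piece j, fun x hx => ?_, hVo.inter (isOpen_piece j), hVt, hmem⟩
  exact ((hV hx.1).2 : g x = h x).trans (hj x hx.2)

theorem isPurelyNonHausdorff_iff (ζ : Word) : IsPurelyNonHausdorff gens ζ ↔ ζ = zeroWord := by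
  constructor
  · rintro ⟨⟨-, h, -⟩, -⟩
    -- Condition (i) at `g = 1` makes `ζ` itself singular for some generator, and only `0^ω` is.
    exact isSingularOfGenerators_iff.1 ((h 1 (Subgroup.one_mem _)).2 rfl)
  · rintro rfl
    exact ⟨isGermDefining_zeroWord, fun g hg h0 => accPt_interior_fixed hg h0⟩

end Singularity

/-! ### Arithmetic in ℤ[η] and decidable positivity -/

section Coefficients

/-- The coefficients of a polynomial of degree at most four. -/
abbrev Coef : Type := ℤ × ℤ × ℤ × ℤ × ℤ

/-- The value of a polynomial. -/
def Coef.eval (η : ℝ) (k : Coef) : ℝ :=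
  k.1 + k.2.1 * η + k.2.2.1 * η ^ 2 + k.2.2.2.1 * η ^ 3 + k.2.2.2.2 * η ^ 4

theorem Coef.eval_add (η : ℝ) (k l : Coef) : (k + l).eval η = k.eval η + l.eval η := by
  simp only [Coef.eval, Prod.fst_add, Prod.snd_add, Int.cast_add]
  ring

theorem Coef.eval_sub (η : ℝ) (k l : Coef) : (k - l).eval η = k.eval η - l.eval η := by
  simp only [Coef.eval, Prod.fst_sub, Prod.snd_sub, Int.cast_sub]
  ring

theorem Coef.eval_zero (η : ℝ) : (0 : Coef).eval η = 0 := by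
  simp [Coef.eval]

/-- Multiplication by `η`, where `η ^ 5 = 2 - η ^ 3 - η ^ 4`. -/
def Coef.shift (k : Coef) : Coef :=
  (2 * k.2.2.2.2, k.1, k.2.1, k.2.2.1 - k.2.2.2.2, k.2.2.2.1 - k.2.2.2.2)

theorem Coef.eval_shift {η : ℝ} (hη : η ^ 5 + η ^ 4 + η ^ 3 - 2 = 0) (k : Coef) :
    k.shift.eval η = η * k.eval η := by
  simp only [Coef.eval, Coef.shift]
  push_cast
  linear_combination (-(k.2.2.2.2 : ℝ)) * hη

/-- A lower bound for `k * t` when `lo ≤ t ≤ hi`. -/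
def termBound (k lo hi : ℤ) : ℤ := if 0 ≤ k then k * lo else k * hi

theorem termBound_le {k lo hi : ℤ} {t : ℝ} (h1 : (lo : ℝ) ≤ t) (h2 : t ≤ hi) :
    (termBound k lo hi : ℝ) ≤ k * t := by
  unfold termBound
  split_ifs with hk
  · push_cast
    exact mul_le_mul_of_nonneg_left h1 (by exact_mod_cast hk)
  · push_cast
    exact mul_le_mul_of_nonpos_left h2 (by exact_mod_cast (not_le.1 hk).le)

/-- A sufficient condition for `k.eval η` to be nonnegative when `0.9028 ≤ η ≤ 0.9029`. -/
def Coef.Ok (k : Coef) : Prop :=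
  0 ≤ termBound k.1 (10 ^ 16) (10 ^ 16) + termBound k.2.1 (9028 * 10 ^ 12) (9029 * 10 ^ 12) +
    termBound k.2.2.1 (9028 ^ 2 * 10 ^ 8) (9029 ^ 2 * 10 ^ 8) +
    termBound k.2.2.2.1 (9028 ^ 3 * 10 ^ 4) (9029 ^ 3 * 10 ^ 4) +
    termBound k.2.2.2.2 (9028 ^ 4) (9029 ^ 4)

instance (k : Coef) : Decidable k.Ok := by unfold Coef.Ok; infer_instance

/-- Interval arithmetic, scaled by `10 ^ 16` so that the bounds for all powers up to `η ^ 4` are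
integers. -/
theorem Coef.Ok.eval_nonneg {k : Coef} (hk : k.Ok) {η : ℝ} (h1 : 0.9028 ≤ η) (h2 : η ≤ 0.9029) :
    0 ≤ k.eval η := by
  have hp : ∀ n : ℕ, (0.9028 : ℝ) ^ n ≤ η ^ n ∧ η ^ n ≤ 0.9029 ^ n := fun n =>
    ⟨pow_le_pow_left₀ (by norm_num) h1 n, pow_le_pow_left₀ (by linarith) h2 n⟩
  have e0 := termBound_le (k := k.1) (lo := 10 ^ 16) (hi := 10 ^ 16) (t := 10 ^ 16)
    (by norm_num) (by norm_num)
  have e1 := termBound_le (k := k.2.1) (lo := 9028 * 10 ^ 12) (hi := 9029 * 10 ^ 12)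
    (t := 10 ^ 16 * η) (by push_cast; linarith) (by push_cast; linarith)
  have e2 := termBound_le (k := k.2.2.1) (lo := 9028 ^ 2 * 10 ^ 8) (hi := 9029 ^ 2 * 10 ^ 8)
    (t := 10 ^ 16 * η ^ 2) (by push_cast; linarith [(hp 2).1]) (by push_cast; linarith [(hp 2).2])
  have e3 := termBound_le (k := k.2.2.2.1) (lo := 9028 ^ 3 * 10 ^ 4) (hi := 9029 ^ 3 * 10 ^ 4)
    (t := 10 ^ 16 * η ^ 3) (by push_cast; linarith [(hp 3).1]) (by push_cast; linarith [(hp 3).2])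
  have e4 := termBound_le (k := k.2.2.2.2) (lo := 9028 ^ 4) (hi := 9029 ^ 4)
    (t := 10 ^ 16 * η ^ 4) (by push_cast; linarith [(hp 4).1]) (by push_cast; linarith [(hp 4).2])
  have hk' : ((0 : ℤ) : ℝ) ≤ ((_ : ℤ) : ℝ) := Int.cast_le.2 hk
  simp only [Int.cast_add, Int.cast_zero] at hk'
  unfold Coef.eval
  linarith

end Coefficients

/-! ### Weights of words and their contraction under sections -/

section Weights

/-- The letters for the generators `a`, `b`, `c₀`, `c₁`, `c₂`. -/
inductive Letter : Type
  | a : Letter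
  | b : Letter
  | c : Fin 3 → Letter
  deriving DecidableEq, Fintype

namespace Letter

/-- The generator of the unfragmented group to which a letter belongs. -/
def kind : Letter → Fin 3
  | a => 0
  | b => 1
  | c _ => 2

/-- The action on the last letter of a word. -/
def move : Letter → Fin 2 → Fin 2
  | a, p => p + 1
  | b, p => p
  | c _, p => p

/-- The section of a generator, `none` for the trivial one. -/
def emit : Letter → Fin 2 → Option Letter
  | a, _ => none
  | b, p => if p = 0 then none else some a
  | c i, p => if p = 0 then some (c (i + 1)) else if i = 2 then none else some b

/-- The weight of a letter. -/
def weight : Letter → Coef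
  | a => (12, 6, -6, 0, -6)
  | b => (6, -6, 6, 0, 6)
  | c 0 => (-6, 6, 12, 9, 3)
  | c 1 => (-12, 12, 6, 9, 6)
  | c 2 => (-6, 6, 12, 0, 3)

/-- The share of `η` times the weight of a letter that pays for the section at a given place. -/
def share : Fin 2 → Letter → Coef
  | 0, a => (6, -6, 6, 0, -3)
  | 0, b => 0
  | 0, c 0 => (0, 0, 0, 9, 0)
  | 0, c 1 => (6, -6, 6, 0, -3)
  | 0, c 2 => (6, -6, 6, 9, -3)
  | 1, a => (-18, 18, 0, 0, 9)
  | 1, b => (12, 6, -6, 0, -6)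
  | 1, c 2 => 0
  | 1, c _ => (6, -6, 6, 0, 6)

/-- The weight of two neighbouring letters `c i` and `c j`. -/
def mergeWeight : Fin 3 → Fin 3 → Coef
  | 0, 0 => (-4, 4, -4, 6, 2)
  | 1, 1 => (8, -8, 8, 6, -4)
  | 2, 2 => (12, -12, 12, 0, -6)
  | 0, 1 => (2, -2, 2, 6, -1)
  | 1, 0 => (2, -2, 2, 6, -1)
  | 0, 2 => (0, 0, 0, 9, 0)
  | 2, 0 => (0, 0, 0, 9, 0)
  | 1, 2 => (6, -6, 6, 9, -3)
  | 2, 1 => (6, -6, 6, 9, -3)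

/-- The weight of two neighbouring letters. -/
def dist : Letter → Letter → Coef
  | a, a => 0
  | b, b => 0
  | c i, c j => mergeWeight i j
  | x, y => x.weight + y.weight

/-- `dist`, with the value zero at the ends of a word. -/
def distO : Option Letter → Option Letter → Coef
  | some x, some y => dist x y
  | _, _ => 0

/-- The part of the potential that depends on the last letter of the section. -/
def basePotential : Letter → Coef
  | a => 0
  | b => (-6, -12, 12, 0, 12)
  | c 0 => (0, 0, 0, 9, 0)
  | c 1 => (-6, 6, -6, 9, 3)
  | c 2 => 0

/-- The potential for a letter `c i` as the last letter of the section. -/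
def potentialC : Letter → Fin 2 → Coef
  | a, 0 => 0
  | b, _ => (6, -6, 6, 0, -3)
  | a, _ => (12, -12, 12, 0, -6)
  | c _, _ => (-6, 6, 12, 0, 3)

/-- The potential for a letter `a` or `b` as the last letter of the section. -/
def potentialAB : Letter → Fin 2 → Coef
  | a, 0 => (-6, 24, -6, 0, 3)
  | b, _ => (0, 18, 0, 0, 0)
  | a, _ => (30, -12, -6, 0, -15)
  | c _, _ => (12, 6, -6, 0, -6)

/-- The amount that has been paid, but not been used since the letter `e` of the section was
written, when the last letter of the word is `l` and the current place is `p`. -/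
def potential : Option Letter → Letter → Fin 2 → Coef
  | none, _, _ => 0
  | some e, l, p => if (emit l p).isSome then 0 else
      basePotential e + if e.kind = 2 then potentialC l p else potentialAB l p

/-- Only `a` moves the place, and `a` emits nothing. So the place after a letter can be used in the
bookkeeping instead of the place before it. -/
theorem emit_move (l : Letter) (p : Fin 2) : emit l (move l p) = emit l p := by
  revert l p; decide

theorem ok_dist : ∀ x y : Letter, (dist x y).Ok := by decide +kernel

/-- The source of the threshold `18`, below which a reduced word has at most one letter. -/
theorem ok_dist_of_kind_ne : ∀ x y : Letter, x.kind ≠ y.kind →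
    (dist x y - (18, 0, 0, 0, 0)).Ok := by decide +kernel

/-- A triangle inequality: cancelling `x x` does not raise the weight, whatever the neighbours are.
-/
theorem ok_delete : ∀ (z : Option Letter) (x : Letter) (y : Option Letter),
    (distO z (some x) + dist x x + distO (some x) y - distO z y).Ok := by decide +kernel

theorem ok_merge : ∀ (z : Option Letter) (i j : Fin 3) (y : Option Letter), i ≠ j →
    (distO z (some (c i)) + dist (c i) (c j) + distO (some (c j)) y -
      (distO z (some (c (third i j))) + distO (some (c (third i j))) y)).Ok := by
  decide +kernel

/-- Conservation of credit: `η` times the weight of a pair is exactly what the two sections receive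
for it. -/
theorem shift_dist : ∀ x y : Letter, x.kind ≠ y.kind →
    (dist x y).shift = share 0 x + share 0 y + (share 1 x + share 1 y) := by decide +kernel

theorem ok_potential : ∀ (e : Option Letter) (l : Letter) (p : Fin 2), (potential e l p).Ok := by
  decide +kernel

theorem potential_start : ∀ (l : Letter) (p : Fin 2),
    potential (emit l p) l (move l p) = 0 := by decide +kernel

/-- One step of the amortized count: the saved potential and the new shares pay for the newly
emitted pair and for the next potential. Here `e` is the leftmost letter of the section so far, and
`p` is the place between `l` and `y`. -/
theorem ok_step : ∀ (e : Option Letter) (l y : Letter) (p : Fin 2), l.kind ≠ y.kind →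
    ((emit l p).isSome → e = emit l p) →
    (potential e l p + (share p y + share p l) -
      (distO (emit y p) e + potential (emit y p <|> e) y (move y p))).Ok := by decide +kernel

end Letter

open Letter

/-- The generator named by a letter. -/
noncomputable def gen : Letter → (Word ≃ₜ Word)
  | .a => FragK110.a
  | .b => FragK110.b
  | .c i => cGen i

/-- The homeomorphism defined by a list of letters. -/
noncomputable def val (w : List Letter) : Word ≃ₜ Word := (w.map gen).prod

/-- The action of a list of letters on the last letter of a word. -/
def pos (p : Fin 2) : List Letter → Fin 2
  | [] => p
  | y :: w => move y (pos p w)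

/-- The section of a list of letters. -/
def sec (p : Fin 2) : List Letter → List Letter
  | [] => []
  | y :: w => (emit y (pos p w)).toList ++ sec p w

theorem val_cons (y : Letter) (w : List Letter) : val (y :: w) = gen y * val w := by
  simp [val]

theorem val_append (v w : List Letter) : val (v ++ w) = val v * val w := by
  simp [val]

theorem gen_snoc (y : Letter) (v : Word) (p : Fin 2) :
    gen y (snoc v p) = snoc (val (emit y p).toList v) (move y p) := by
  rcases y with _ | _ | i
  · refine (wreath_a v p).trans ?_
    fin_cases p <;> rfl
  · refine (wreath_b v p).trans ?_
    fin_cases p <;> simp [val, emit, move, gen]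
  · fin_cases i
    · refine (wreath_c₀ v p).trans ?_
      fin_cases p <;> simp [val, emit, move, gen, cGen]
    · refine (wreath_c₁ v p).trans ?_
      fin_cases p <;> simp [val, emit, move, gen, cGen]
    · refine (wreath_c₂ v p).trans ?_
      fin_cases p <;> simp [val, emit, move, gen, cGen]

theorem val_snoc (w : List Letter) (v : Word) (p : Fin 2) :
    val w (snoc v p) = snoc (val (sec p w) v) (pos p w) := by
  induction w with
  | nil => rfl
  | cons y w ih =>
    rw [val_cons, Homeomorph.mul_apply, ih, gen_snoc, sec, val_append]
    rfl

theorem pos_one (w : List Letter) : pos 1 w = pos 0 w + 1 := by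
  induction w with
  | nil => rfl
  | cons y w ih =>
    have h : ∀ (y : Letter) (p : Fin 2), move y (p + 1) = move y p + 1 := by decide
    rw [pos, pos, ih, h]

/-- The weight of a list of letters with the letter `z` to the left of it. -/
noncomputable def wt (η : ℝ) : Option Letter → List Letter → ℝ
  | _, [] => 0
  | z, y :: w => (distO z (some y)).eval η + wt η (some y) w

/-- Neighbouring letters are of different kind. -/
def Reduced (w : List Letter) : Prop := w.IsChain fun x y => x.kind ≠ y.kind

/-- The part of the weight of a list that pays for a section. -/
noncomputable def budget (η : ℝ) (p : Fin 2) : List Letter → ℝ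
  | [] => 0
  | [_] => 0
  | y :: x :: w => (share (pos p (x :: w)) y + share (pos p (x :: w)) x).eval η +
      budget η p (x :: w)

theorem distO_none_right (z : Option Letter) : distO z none = 0 := by cases z <;> rfl

theorem distO_none_left (z : Option Letter) : distO none z = 0 := by cases z <;> rfl

theorem wt_eq (η : ℝ) (z : Option Letter) (w : List Letter) :
    wt η z w = (distO z w.head?).eval η + wt η none w := by
  cases w with
  | nil => simp [wt, distO_none_right, Coef.eval_zero]
  | cons y w => simp [wt, distO_none_left, Coef.eval_zero]

variable {η : ℝ}

theorem wt_nonneg (h1 : 0.9028 ≤ η) (h2 : η ≤ 0.9029) (z : Option Letter) (w : List Letter) :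
    0 ≤ wt η z w := by
  induction w generalizing z with
  | nil => exact le_rfl
  | cons y w ih =>
    refine add_nonneg ?_ (ih _)
    cases z with
    | none => rw [distO_none_left, Coef.eval_zero]
    | some x => exact (ok_dist x y).eval_nonneg h1 h2

/-- Cancel `x x` and merge `c i c j` whenever a letter is put in front of a reduced word. The weight
bound is needed for every left neighbour `z`, since the induction adds letters on the left. -/
theorem exists_reduced (h1 : 0.9028 ≤ η) (h2 : η ≤ 0.9029) (w : List Letter) :
    ∃ w', Reduced w' ∧ val w' = val w ∧ ∀ z, wt η z w' ≤ wt η z w := by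
  induction w with
  | nil => exact ⟨[], List.isChain_nil, rfl, fun z => le_rfl⟩
  | cons x w ih =>
    obtain ⟨w', hr, hv, hw⟩ := ih
    have hle : ∀ z, wt η z (x :: w') ≤ wt η z (x :: w) := fun z => by
      simpa [wt] using hw (some x)
    cases w' with
    | nil =>
      exact ⟨[x], List.isChain_singleton _, by rw [val_cons, hv, ← val_cons], hle⟩
    | cons y t =>
      have ht : Reduced t := List.IsChain.tail hr
      by_cases hk : x.kind = y.kind
      · by_cases hxy : x = y
        · subst hxy
          refine ⟨t, ht, ?_, fun z => le_trans ?_ (hle z)⟩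
          · have hg : gen x * gen x = 1 := by
              cases x
              exacts [a_mul_a, b_mul_b, cGen_mul_self _]
            rw [val_cons, ← hv, val_cons, ← mul_assoc, hg, one_mul]
          · have h := (ok_delete z x t.head?).eval_nonneg h1 h2
            simp only [Coef.eval_sub, Coef.eval_add] at h
            simp only [wt]
            rw [wt_eq η z t, wt_eq η (some x) t]
            change _ ≤ _ + ((dist x x).eval η + _)
            linarith
        · obtain ⟨i, j, rfl, rfl⟩ : ∃ i j, x = .c i ∧ y = .c j := by
            revert hk hxy
            cases x <;> cases y <;> simp [kind]
          have hij : i ≠ j := fun h => hxy (congrArg _ h)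
          refine ⟨.c (third i j) :: t, ?_, ?_, fun z => le_trans ?_ (hle z)⟩
          · cases t with
            | nil => exact List.isChain_singleton _
            | cons y' t => exact List.isChain_cons_cons.2 (List.isChain_cons_cons.1 hr)
          · rw [val_cons, val_cons, ← hv, val_cons, ← mul_assoc]
            exact congrArg (· * val t) (cGen_mul_cGen hij).symm
          · have h := (ok_merge z i j t.head? hij).eval_nonneg h1 h2
            simp only [Coef.eval_sub, Coef.eval_add] at h
            simp only [wt]
            rw [wt_eq η (some (.c (third i j))) t, wt_eq η (some (.c j)) t]
            change _ ≤ _ + ((dist (.c i) (.c j)).eval η + _)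
            linarith
      · exact ⟨x :: y :: t, List.isChain_cons_cons.2 ⟨hk, hr⟩,
          by rw [val_cons, hv, ← val_cons], hle⟩

/-- The potential strengthens the bound so that induction on the word works, each step being
`ok_step`. -/
theorem wt_sec_le_budget (h1 : 0.9028 ≤ η) (h2 : η ≤ 0.9029) (p : Fin 2) (l : Letter)
    (w : List Letter) (hr : Reduced (l :: w)) :
    wt η none (sec p (l :: w)) + (potential (sec p (l :: w)).head? l (pos p (l :: w))).eval η ≤
      budget η p (l :: w) := by
  induction w generalizing l with
  | nil =>
    have hs : sec p [l] = (emit l p).toList := by simp [sec, pos]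
    have hw : wt η none (emit l p).toList = 0 := by
      cases emit l p <;> simp [wt, distO, Coef.eval_zero]
    have hh : (emit l p).toList.head? = emit l p := by cases emit l p <;> rfl
    rw [hs, hw, hh]
    change 0 + (potential (emit l p) l (move l p)).eval η ≤ 0
    rw [potential_start, Coef.eval_zero, add_zero]
  | cons x w ih =>
    obtain ⟨hk, hr'⟩ := List.isChain_cons_cons.1 hr
    have hx := ih x hr'
    set s := sec p (x :: w) with hs
    set q := pos p (x :: w) with hq
    have hsec : sec p (l :: x :: w) = (emit l q).toList ++ s := rfl
    have hhead : (sec p (l :: x :: w)).head? = (emit l q <|> s.head?) := by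
      rw [hsec]
      cases emit l q <;> simp
    have hwt : wt η none (sec p (l :: x :: w)) =
        (distO (emit l q) s.head?).eval η + wt η none s := by
      rw [hsec]
      cases emit l q with
      | none => simp [distO_none_left, Coef.eval_zero]
      | some f =>
        change (distO none (some f)).eval η + wt η (some f) s = _
        rw [wt_eq η (some f) s, distO_none_left, Coef.eval_zero, zero_add]
    -- If `x` has emitted a letter, it is the head of the section. This excludes the inconsistent
    -- states in which `ok_step` is not claimed.
    have hcons : (emit x q).isSome → s.head? = emit x q := by
      have he : emit x q = emit x (pos p w) := emit_move x _
      intro h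
      rw [he] at h ⊢
      rw [hs, sec]
      obtain ⟨f, hf⟩ := Option.isSome_iff_exists.1 h
      rw [hf]
      rfl
    have hst := (ok_step s.head? x l q hk.symm hcons).eval_nonneg h1 h2
    simp only [Coef.eval_sub, Coef.eval_add] at hst
    have hb : budget η p (l :: x :: w) = (share q l + share q x).eval η + budget η p (x :: w) := rfl
    have hpos : pos p (l :: x :: w) = move l q := rfl
    rw [hwt, hhead, hb, hpos, Coef.eval_add]
    linarith

/-- The two starting places stay different under every letter, so each pair contributes its shares
at both places once. -/
theorem budget_add_budget (hη : η ^ 5 + η ^ 4 + η ^ 3 - 2 = 0) (l : Letter) (w : List Letter)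
    (hr : Reduced (l :: w)) :
    budget η 0 (l :: w) + budget η 1 (l :: w) = η * wt η none (l :: w) := by
  induction w generalizing l with
  | nil => simp [budget, wt, distO_none_left, Coef.eval_zero]
  | cons x w ih =>
    obtain ⟨hk, hr'⟩ := List.isChain_cons_cons.1 hr
    have hx := ih x hr'
    have hd := congrArg (Coef.eval η) (shift_dist l x hk)
    rw [Coef.eval_shift hη] at hd
    have hw : wt η none (l :: x :: w) = (dist l x).eval η + wt η none (x :: w) := by
      simp only [wt, distO_none_left, Coef.eval_zero, zero_add]
      rfl
    have hsum : ∀ q : Fin 2, share q l + share q x + (share (q + 1) l + share (q + 1) x) =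
        share 0 l + share 0 x + (share 1 l + share 1 x) := by
      intro q
      fin_cases q
      · rfl
      · exact add_comm _ _
    have hs := congrArg (Coef.eval η) (hsum (pos 0 (x :: w)))
    rw [Coef.eval_add _ (share _ l + share _ x)] at hs
    rw [budget, budget, pos_one, hw, mul_add, hd, ← hs]
    linarith

theorem wt_sec_add_wt_sec_le (h1 : 0.9028 ≤ η) (h2 : η ≤ 0.9029)
    (hη : η ^ 5 + η ^ 4 + η ^ 3 - 2 = 0) {w : List Letter} (hr : Reduced w) :
    wt η none (sec 0 w) + wt η none (sec 1 w) ≤ η * wt η none w := by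
  cases w with
  | nil => simp [sec, wt]
  | cons l w =>
    rw [← budget_add_budget hη l w hr]
    have e0 := wt_sec_le_budget h1 h2 0 l w hr
    have e1 := wt_sec_le_budget h1 h2 1 l w hr
    have n0 := (ok_potential (sec 0 (l :: w)).head? l (pos 0 (l :: w))).eval_nonneg h1 h2
    have n1 := (ok_potential (sec 1 (l :: w)).head? l (pos 1 (l :: w))).eval_nonneg h1 h2
    linarith

theorem length_le_one_of_wt_lt (h1 : 0.9028 ≤ η) (h2 : η ≤ 0.9029) {w : List Letter}
    (hr : Reduced w) (hw : wt η none w < 18) : w.length ≤ 1 := by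
  match w with
  | [] => simp
  | [_] => simp
  | x :: y :: t =>
    exfalso
    have hd := (ok_dist_of_kind_ne x y (List.isChain_cons_cons.1 hr).1).eval_nonneg h1 h2
    rw [Coef.eval_sub] at hd
    have ht := wt_nonneg h1 h2 (some y) t
    have e : wt η none (x :: y :: t) = (dist x y).eval η + wt η (some y) t := by
      simp only [wt, distO_none_left, Coef.eval_zero, zero_add]
      rfl
    have e18 : Coef.eval η (18, 0, 0, 0, 0) = 18 := by simp [Coef.eval]
    linarith

theorem wt_le_length (h1 : 0.9028 ≤ η) (h2 : η ≤ 0.9029) (z : Option Letter) (w : List Letter) :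
    wt η z w ≤ 100 * w.length := by
  have hd : ∀ x y : Letter, Coef.Ok ((100, 0, 0, 0, 0) - dist x y) := by decide +kernel
  have e100 : Coef.eval η (100, 0, 0, 0, 0) = 100 := by simp [Coef.eval]
  induction w generalizing z with
  | nil => simp [wt]
  | cons y w ih =>
    have hz : (distO z (some y)).eval η ≤ 100 := by
      cases z with
      | none => rw [distO_none_left, Coef.eval_zero]; norm_num
      | some x =>
        have := (hd x y).eval_nonneg h1 h2
        rw [Coef.eval_sub, e100] at this
        exact sub_nonneg.1 this
    have := ih (some y)
    simp only [wt, List.length_cons]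
    push_cast
    linarith

end Weights

/-! ### Counting portraits -/

section Portraits

/-- `g` is described by a binary tree with `n` inner vertices: at an inner vertex the action on the
last letter is recorded, and the leaves are labelled by words of length at most one. -/
inductive Portrait : ℕ → (Word ≃ₜ Word) → Prop
  | leaf (w : List Letter) (hw : w.length ≤ 1) : Portrait 0 (val w)
  | node {i j : ℕ} {g g₀ g₁ : Word ≃ₜ Word} (p : Fin 2) (h₀ : Portrait i g₀) (h₁ : Portrait j g₁)
      (hg₀ : ∀ v, g (snoc v 0) = snoc (g₀ v) p) (hg₁ : ∀ v, g (snoc v 1) = snoc (g₁ v) (p + 1)) :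
      Portrait (i + j + 1) g

theorem eq_of_sections_eq {g h g₀ g₁ : Word ≃ₜ Word} {p : Fin 2}
    (hg₀ : ∀ v, g (snoc v 0) = snoc (g₀ v) p) (hg₁ : ∀ v, g (snoc v 1) = snoc (g₁ v) (p + 1))
    (hh₀ : ∀ v, h (snoc v 0) = snoc (g₀ v) p) (hh₁ : ∀ v, h (snoc v 1) = snoc (g₁ v) (p + 1)) :
    g = h := by
  ext1 w
  rw [← snoc_init w]
  by_cases h0 : w 0 = 0
  · rw [h0, hg₀, hh₀]
  · rw [fin2_ne _ h0, hg₁, hh₁]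

open Classical in
/-- The homeomorphism with given sections, if there is one. -/
noncomputable def ofSections (p : Fin 2) (g₀ g₁ : Word ≃ₜ Word) : Word ≃ₜ Word :=
  if h : ∃ g : Word ≃ₜ Word,
    (∀ v, g (snoc v 0) = snoc (g₀ v) p) ∧ ∀ v, g (snoc v 1) = snoc (g₁ v) (p + 1)
  then h.choose else 1

theorem ofSections_eq {g g₀ g₁ : Word ≃ₜ Word} {p : Fin 2}
    (hg₀ : ∀ v, g (snoc v 0) = snoc (g₀ v) p) (hg₁ : ∀ v, g (snoc v 1) = snoc (g₁ v) (p + 1)) :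
    ofSections p g₀ g₁ = g := by
  have h : ∃ g : Word ≃ₜ Word,
    (∀ v, g (snoc v 0) = snoc (g₀ v) p) ∧ ∀ v, g (snoc v 1) = snoc (g₁ v) (p + 1) :=
    ⟨g, hg₀, hg₁⟩
  rw [ofSections, dif_pos h]
  exact eq_of_sections_eq h.choose_spec.1 h.choose_spec.2 hg₀ hg₁

-- There are `catalan n` tree shapes, two labels for each of the `n` inner vertices and six labels
-- (five letters and the empty word) for each of the `n + 1` leaves.
open Classical in
theorem exists_finset_portrait (n : ℕ) : ∃ F : Finset (Word ≃ₜ Word),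
    (∀ g, Portrait n g → g ∈ F) ∧ F.card ≤ 6 * 12 ^ n * catalan n := by
  induction n using Nat.strong_induction_on with
  | _ n ih =>
    cases n with
    | zero =>
      refine ⟨Finset.univ.image fun o : Option Letter => val o.toList, ?_, ?_⟩
      · rintro _ ⟨w, hw⟩
        match w, hw with
        | [], _ => exact Finset.mem_image.2 ⟨none, Finset.mem_univ _, rfl⟩
        | [x], _ => exact Finset.mem_image.2 ⟨some x, Finset.mem_univ _, rfl⟩
      · refine Finset.card_image_le.trans ?_
        rw [catalan_zero]
        exact (by decide : Fintype.card (Option Letter) ≤ 6)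
    | succ n =>
      have ih' : ∀ k, ∃ F : Finset (Word ≃ₜ Word), k ≤ n →
          (∀ g, Portrait k g → g ∈ F) ∧ F.card ≤ 6 * 12 ^ k * catalan k := fun k => by
        by_cases hk : k ≤ n
        · obtain ⟨F, hF⟩ := ih k (by omega)
          exact ⟨F, fun _ => hF⟩
        · exact ⟨∅, fun h => absurd h hk⟩
      choose F hF using ih'
      refine ⟨(Finset.HasAntidiagonal.antidiagonal n).biUnion fun ij =>
        (Finset.univ ×ˢ F ij.1 ×ˢ F ij.2).image fun t => ofSections t.1 t.2.1 t.2.2, ?_, ?_⟩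
      · intro g hg
        generalize hm : n + 1 = m at hg
        cases hg with
        | leaf w hw => omega
        | @node i j _ g₀ g₁ p h₀ h₁ hg₀ hg₁ =>
          refine Finset.mem_biUnion.2 ⟨(i, j), Finset.HasAntidiagonal.mem_antidiagonal.2 (by omega), ?_⟩
          refine Finset.mem_image.2 ⟨(p, g₀, g₁), ?_, ofSections_eq hg₀ hg₁⟩
          exact Finset.mem_product.2 ⟨Finset.mem_univ _, Finset.mem_product.2
            ⟨(hF i (by omega)).1 _ h₀, (hF j (by omega)).1 _ h₁⟩⟩
      · refine Finset.card_biUnion_le.trans ?_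
        rw [catalan_succ', Finset.mul_sum]
        refine Finset.sum_le_sum fun ij hij => Finset.card_image_le.trans ?_
        have hn := Finset.HasAntidiagonal.mem_antidiagonal.1 hij
        rw [Finset.card_product, Finset.card_product, Finset.card_univ, Fintype.card_fin]
        calc 2 * ((F ij.1).card * (F ij.2).card)
            ≤ 2 * ((6 * 12 ^ ij.1 * catalan ij.1) * (6 * 12 ^ ij.2 * catalan ij.2)) := by
              gcongr
              exacts [(hF _ (by omega)).2, (hF _ (by omega)).2]
          _ = 6 * 12 ^ (n + 1) * (catalan ij.1 * catalan ij.2) := by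
              rw [← hn]; ring

theorem catalan_le_four_pow (n : ℕ) : catalan n ≤ 4 ^ n := by
  rw [catalan_eq_centralBinom_div]
  exact (Nat.div_le_self _ _).trans (Nat.centralBinom_le_four_pow n)

theorem ncard_le_of_portrait {s : Set (Word ≃ₜ Word)} {M : ℕ}
    (hs : ∀ g ∈ s, ∃ n ≤ M, Portrait n g) : s.ncard ≤ 48 ^ (M + 2) := by
  classical
  choose F hF using exists_finset_portrait
  have hsub : s ⊆ ((Finset.range (M + 1)).biUnion F : Finset (Word ≃ₜ Word)) := by
    intro g hg
    obtain ⟨n, hn, hp⟩ := hs g hg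
    exact Finset.mem_coe.2 (Finset.mem_biUnion.2
      ⟨n, Finset.mem_range.2 (by omega), (hF n).1 g hp⟩)
  refine (Set.ncard_le_ncard hsub (Finset.finite_toSet _)).trans ?_
  rw [Set.ncard_coe_finset]
  refine Finset.card_biUnion_le.trans ?_
  have h1 : ∀ n ∈ Finset.range (M + 1), (F n).card ≤ 6 * 48 ^ n := fun n _ => by
    calc (F n).card ≤ 6 * 12 ^ n * catalan n := (hF n).2
      _ ≤ 6 * 12 ^ n * 4 ^ n := Nat.mul_le_mul_left _ (catalan_le_four_pow n)
      _ = 6 * 48 ^ n := by rw [mul_assoc, ← mul_pow]; norm_num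
  refine (Finset.sum_le_sum h1).trans ?_
  rw [← Finset.mul_sum]
  have h2 := Nat.geomSum_lt (m := 48) (n := M + 1) (s := Finset.range (M + 1)) (by norm_num)
    fun k hk => Finset.mem_range.1 hk
  calc 6 * ∑ n ∈ Finset.range (M + 1), 48 ^ n ≤ 48 * 48 ^ (M + 1) := by gcongr; norm_num
    _ = 48 ^ (M + 2) := by ring

end Portraits

/-! ### From contraction to the growth bound -/

section GrowthEstimate

variable {η : ℝ}

theorem rpow_add_rpow_le {α x y : ℝ} (h0 : 0 ≤ α) (h1 : α ≤ 1) (hx : 0 ≤ x) (hy : 0 ≤ y) :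
    x ^ α + y ^ α ≤ 2 * ((x + y) / 2) ^ α := by
  have h := (Real.concaveOn_rpow h0 h1).2 (Set.mem_Ici.2 hx) (Set.mem_Ici.2 hy)
    (by norm_num : (0 : ℝ) ≤ 1 / 2) (by norm_num : (0 : ℝ) ≤ 1 / 2) (by norm_num)
  simp only [smul_eq_mul] at h
  rw [show (x + y) / 2 = 1 / 2 * x + 1 / 2 * y by ring]
  linarith

/-- With `x` the weight of the reduced word, concavity and contraction bound the sum of the
`α`-powers of the section weights by `θ * x ^ α`. The constant `K` is such that for `x ≥ 18` the
remaining `K * (1 - θ) * x ^ α` is at least `1` and pays for the root. -/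
theorem exists_portrait (h1 : 0.9028 ≤ η) (h2 : η ≤ 0.9029) (hη : η ^ 5 + η ^ 4 + η ^ 3 - 2 = 0)
    {α : ℝ} (hα0 : 0 < α) (hα1 : α ≤ 1) (hθ : 2 * (η / 2) ^ α < 1) (w : List Letter) :
    ∃ n : ℕ, Portrait n (val w) ∧
      (n : ℝ) ≤ ((1 - 2 * (η / 2) ^ α) * 18 ^ α)⁻¹ * wt η none w ^ α := by
  set θ := 2 * (η / 2) ^ α with hθdef
  set K := ((1 - θ) * 18 ^ α)⁻¹ with hK
  have h18 : (0 : ℝ) < 18 ^ α := Real.rpow_pos_of_pos (by norm_num) α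
  have hK0 : 0 < K := inv_pos.2 (mul_pos (by linarith) h18)
  have hη0 : 0 < η := by linarith
  -- Sections need not be shorter in a way that controls real weights, so the induction runs over
  -- the scale `m`, which drops by one as the weight contracts by `η`.
  have main : ∀ (m : ℕ) (w : List Letter), wt η none w < 18 * η⁻¹ ^ m →
      ∃ n : ℕ, Portrait n (val w) ∧ (n : ℝ) ≤ K * wt η none w ^ α := by
    intro m
    induction m with
    | zero =>
      intro w hw
      obtain ⟨w', hr, hv, hle⟩ := exists_reduced h1 h2 w
      rw [pow_zero, mul_one] at hw
      refine ⟨0, hv ▸ .leaf w' (length_le_one_of_wt_lt h1 h2 hr ((hle none).trans_lt hw)), ?_⟩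
      rw [Nat.cast_zero]
      exact mul_nonneg hK0.le (Real.rpow_nonneg (wt_nonneg h1 h2 _ _) _)
    | succ m ih =>
      intro w hw
      obtain ⟨w', hr, hv, hle⟩ := exists_reduced h1 h2 w
      have hx0 := wt_nonneg h1 h2 none w'
      by_cases hlt : wt η none w' < 18
      · refine ⟨0, hv ▸ .leaf w' (length_le_one_of_wt_lt h1 h2 hr hlt), ?_⟩
        rw [Nat.cast_zero]
        exact mul_nonneg hK0.le (Real.rpow_nonneg (wt_nonneg h1 h2 _ _) _)
      · have hsum := wt_sec_add_wt_sec_le h1 h2 hη hr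
        have hs0 := wt_nonneg h1 h2 none (sec 0 w')
        have hs1 := wt_nonneg h1 h2 none (sec 1 w')
        have hbound : η * wt η none w' < 18 * η⁻¹ ^ m := by
          have : η * wt η none w' < η * (18 * η⁻¹ ^ (m + 1)) :=
            mul_lt_mul_of_pos_left ((hle none).trans_lt hw) hη0
          rwa [show η * (18 * η⁻¹ ^ (m + 1)) = 18 * η⁻¹ ^ m * (η * η⁻¹) by ring,
            mul_inv_cancel₀ hη0.ne', mul_one] at this
        obtain ⟨n₀, hp₀, hn₀⟩ := ih (sec 0 w') (by linarith)
        obtain ⟨n₁, hp₁, hn₁⟩ := ih (sec 1 w') (by linarith)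
        refine ⟨n₀ + n₁ + 1, .node (pos 0 w') hp₀ hp₁ (fun v => ?_) (fun v => ?_), ?_⟩
        · rw [← hv, val_snoc]
        · rw [← hv, val_snoc, pos_one]
        · have e1 := rpow_add_rpow_le hα0.le hα1 hs0 hs1
          have e2 : ((wt η none (sec 0 w') + wt η none (sec 1 w')) / 2) ^ α ≤
              (η / 2) ^ α * wt η none w' ^ α := by
            rw [← Real.mul_rpow (by linarith) hx0]
            exact Real.rpow_le_rpow (by linarith) (by linarith) hα0.le
          have e3 : (18 : ℝ) ^ α ≤ wt η none w' ^ α :=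
            Real.rpow_le_rpow (by norm_num) (not_lt.1 hlt) hα0.le
          have e4 : wt η none w' ^ α ≤ wt η none w ^ α :=
            Real.rpow_le_rpow hx0 (hle none) hα0.le
          have e5 : 1 ≤ K * (1 - θ) * wt η none w' ^ α := by
            have : K * (1 - θ) * 18 ^ α = 1 := by
              rw [mul_assoc, hK]
              exact inv_mul_cancel₀ (mul_pos (by linarith) h18).ne'
            exact this.symm.le.trans
              (mul_le_mul_of_nonneg_left e3 (mul_nonneg hK0.le (by linarith)))
          have e6 : wt η none (sec 0 w') ^ α + wt η none (sec 1 w') ^ α ≤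
              θ * wt η none w' ^ α := by rw [hθdef]; linarith
          push_cast
          calc (n₀ : ℝ) + n₁ + 1
              ≤ K * (wt η none (sec 0 w') ^ α + wt η none (sec 1 w') ^ α) +
                K * (1 - θ) * wt η none w' ^ α := by linarith
            _ ≤ K * (θ * wt η none w' ^ α) + K * (1 - θ) * wt η none w' ^ α := by
                gcongr
            _ = K * wt η none w' ^ α := by ring
            _ ≤ K * wt η none w ^ α := by gcongr
  obtain ⟨m, hm⟩ := pow_unbounded_of_one_lt (wt η none w)
    ((one_lt_inv₀ hη0).2 (by linarith : η < 1))
  refine main m w ?_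
  have : 0 ≤ η⁻¹ ^ m := by positivity
  linarith

theorem exists_letters {g : Word ≃ₜ Word} (hg : g ∈ Subgroup.closure gens) :
    ∃ w : List Letter, val w = g ∧ w.length = wordLength gens g := by
  obtain ⟨l, hl, rfl, hlen⟩ := exists_word gens hg
  rw [← hlen]
  clear hlen hg
  induction l with
  | nil => exact ⟨[], rfl, rfl⟩
  | cons s l ih =>
    obtain ⟨w, hw, hwl⟩ := ih fun t ht => hl t (List.mem_cons_of_mem _ ht)
    obtain ⟨y, rfl⟩ : ∃ y, gen y = s := by
      rcases mem_gens_iff.1 (mem_gens_of_inv (hl s List.mem_cons_self)) with rfl | rfl | ⟨i, rfl⟩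
      exacts [⟨.a, rfl⟩, ⟨.b, rfl⟩, ⟨.c i, rfl⟩]
    exact ⟨y :: w, by rw [val_cons, hw, List.prod_cons], by simp [hwl]⟩

theorem growth_dominated (h1 : 0.9028 ≤ η) (h2 : η ≤ 0.9029) (hη : η ^ 5 + η ^ 4 + η ^ 3 - 2 = 0)
    {α : ℝ} (hα0 : 0 < α) (hα1 : α ≤ 1) (hθ : 2 * (η / 2) ^ α < 1) :
    Dominated (fun R => (growth gens R : ℝ)) (fun R => Real.exp (R ^ α)) := by
  set K := ((1 - 2 * (η / 2) ^ α) * 18 ^ α)⁻¹ with hK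
  have hK0 : 0 ≤ K := inv_nonneg.2 (mul_nonneg (by linarith) (by positivity))
  have h100 : (0 : ℝ) ≤ 100 ^ α := by positivity
  have hlog : 0 ≤ Real.log 48 := Real.log_nonneg (by norm_num)
  set B := (K * 100 ^ α + 2) * Real.log 48 with hB
  have hB0 : 0 ≤ B := by positivity
  -- The factor `B` in the exponent becomes a rescaling of `R` by `B ^ α⁻¹`; domination asks for a
  -- constant of at least `1`.
  refine ⟨max 1 (B ^ α⁻¹), le_max_left _ _, fun R hR => ?_⟩
  have hRα : 1 ≤ R ^ α := Real.one_le_rpow hR hα0.le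
  set M := ⌊K * (100 * R) ^ α⌋₊ with hM
  have hcard : growth gens R ≤ 48 ^ (M + 2) := by
    refine ncard_le_of_portrait fun g hg => ?_
    obtain ⟨w, rfl, hw⟩ := exists_letters hg.1
    obtain ⟨n, hp, hn⟩ := exists_portrait h1 h2 hη hα0 hα1 hθ w
    refine ⟨n, Nat.le_floor (hn.trans ?_), hp⟩
    have hwt : wt η none w ≤ 100 * R := by
      have e1 := wt_le_length h1 h2 none w
      have e2 : (w.length : ℝ) ≤ R := by rw [hw]; exact hg.2
      linarith
    exact mul_le_mul_of_nonneg_left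
      (Real.rpow_le_rpow (wt_nonneg h1 h2 _ _) hwt hα0.le) hK0
  have hMle : (M : ℝ) ≤ K * 100 ^ α * R ^ α := by
    rw [mul_assoc, ← Real.mul_rpow (by norm_num) (by linarith)]
    exact Nat.floor_le (mul_nonneg hK0 (Real.rpow_nonneg (by linarith) _))
  calc (growth gens R : ℝ) ≤ (48 : ℝ) ^ (M + 2) := by exact_mod_cast hcard
    _ = Real.exp ((M + 2 : ℝ) * Real.log 48) := by
        rw [← Real.exp_log (show (0 : ℝ) < 48 ^ (M + 2) by positivity), Real.log_pow]
        push_cast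
        rfl
    _ ≤ Real.exp (B * R ^ α) := by
        refine Real.exp_le_exp.2 ?_
        rw [hB, mul_right_comm]
        refine mul_le_mul_of_nonneg_right ?_ hlog
        linarith
    _ ≤ Real.exp ((max 1 (B ^ α⁻¹) * R) ^ α) := by
        refine Real.exp_le_exp.2 ?_
        rw [Real.mul_rpow (le_max_of_le_left zero_le_one) (by linarith)]
        refine mul_le_mul_of_nonneg_right ?_ (by linarith)
        calc B = (B ^ α⁻¹) ^ α := by
              rw [← Real.rpow_mul hB0, inv_mul_cancel₀ hα0.ne', Real.rpow_one]
          _ ≤ _ := Real.rpow_le_rpow (by positivity) (le_max_right _ _) hα0.le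

end GrowthEstimate

/-! ### The root `η` and the numerical exponent -/

section Root

theorem strictMonoOn_quintic : StrictMonoOn (fun x : ℝ => x ^ 5 + x ^ 4 + x ^ 3 - 2) (Set.Ici 0) := by
  intro x hx y _ hxy
  have hx' : (0 : ℝ) ≤ x := hx
  have e5 := pow_lt_pow_left₀ hxy hx' (n := 5) (by norm_num)
  have e4 := pow_lt_pow_left₀ hxy hx' (n := 4) (by norm_num)
  have e3 := pow_lt_pow_left₀ hxy hx' (n := 3) (by norm_num)
  change x ^ 5 + x ^ 4 + x ^ 3 - 2 < y ^ 5 + y ^ 4 + y ^ 3 - 2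
  linarith

theorem exists_root : ∃ η : ℝ, 0.90281 < η ∧ η < 0.90282 ∧ η ^ 5 + η ^ 4 + η ^ 3 - 2 = 0 := by
  have hc : ContinuousOn (fun x : ℝ => x ^ 5 + x ^ 4 + x ^ 3 - 2) (Set.Icc 0.90281 0.90282) := by
    fun_prop
  obtain ⟨η, ⟨h1, h2⟩, h⟩ := intermediate_value_Ioo (by norm_num) hc
    (show (0 : ℝ) ∈ Set.Ioo _ _ from ⟨by norm_num, by norm_num⟩)
  exact ⟨η, h1, h2, h⟩

theorem log_root_bounds {η : ℝ} (h1 : 0.90281 < η) (h2 : η < 0.90282) :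
    -0.102245 < Real.log η ∧ Real.log η < -0.10223 := by
  -- The bounds for `η` are `1 - 0.09719` and `1 - 0.09718`; six terms of the series of `log (1 -
  -- x)` are accurate enough.
  have l1 := Real.abs_log_sub_add_sum_range_le (x := 0.09719) (by norm_num [abs_of_pos]) 6
  have l2 := Real.abs_log_sub_add_sum_range_le (x := 0.09718) (by norm_num [abs_of_pos]) 6
  rw [abs_le, abs_of_pos (by norm_num : (0 : ℝ) < 0.09719)] at l1
  rw [abs_le, abs_of_pos (by norm_num : (0 : ℝ) < 0.09718)] at l2
  simp only [Finset.sum_range_succ, Finset.sum_range_zero] at l1 l2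
  have m1 : Real.log (1 - 0.09719) < Real.log η :=
    Real.log_lt_log (by norm_num) (by linarith)
  have m2 : Real.log η < Real.log (1 - 0.09718) :=
    Real.log_lt_log (by linarith) (by linarith)
  constructor
  · refine lt_trans ?_ m1
    have := l1.1
    norm_num at this ⊢
    linarith
  · refine m2.trans ?_
    have := l2.2
    norm_num at this ⊢
    linarith

theorem exponent_bounds {η : ℝ} (h1 : 0.90281 < η) (h2 : η < 0.90282) :
    |Real.log 2 / (Real.log 2 - Real.log η) - 0.8715| < 0.00005 := by
  obtain ⟨l1, l2⟩ := log_root_bounds h1 h2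
  have d1 := Real.log_two_gt_d9
  have d2 := Real.log_two_lt_d9
  have hpos : 0 < Real.log 2 - Real.log η := by linarith
  rw [abs_lt]
  constructor
  · rw [lt_sub_iff_add_lt, lt_div_iff₀ hpos]
    linarith
  · rw [sub_lt_iff_lt_add, div_lt_iff₀ hpos]
    linarith

/-- Taking logarithms turns the claim into `log 2 < α * (log 2 - log η)`; this is where the critical
exponent comes from. -/
theorem two_mul_rpow_lt_one {η α : ℝ} (h1 : 0 < η) (h2 : η < 1)
    (hα : Real.log 2 / (Real.log 2 - Real.log η) < α) : 2 * (η / 2) ^ α < 1 := by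
  have hlog : Real.log η < 0 := Real.log_neg h1 h2
  have hlog2 : 0 < Real.log 2 := Real.log_pos (by norm_num)
  have h := (div_lt_iff₀ (by linarith)).1 hα
  have hpos : 0 < 2 * (η / 2) ^ α := by positivity
  rw [← Real.log_neg_iff hpos, Real.log_mul (by norm_num) (by positivity),
    Real.log_rpow (by positivity), Real.log_div h1.ne' (by norm_num)]
  linarith

theorem Dominated.exp_rpow_mono {f : ℝ → ℝ} {α β : ℝ} (hαβ : α ≤ β)
    (h : Dominated f fun R => Real.exp (R ^ α)) : Dominated f fun R => Real.exp (R ^ β) := by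
  obtain ⟨C, hC, hf⟩ := h
  refine ⟨C, hC, fun R hR => (hf R hR).trans (Real.exp_le_exp.2 ?_)⟩
  exact Real.rpow_le_rpow_of_exponent_le (by nlinarith) hαβ

end Root

end FragK110

theorem mainTheorem5 :
    -- the wreath recursions of the fragmented generators
    FragK110.HasWreathRecursion FragK110.c₀ 1 ![FragK110.c₁, FragK110.b] ∧
    FragK110.HasWreathRecursion FragK110.c₁ 1 ![FragK110.c₂, FragK110.b] ∧
    FragK110.HasWreathRecursion FragK110.c₂ 1 ![FragK110.c₀, 1] ∧
    -- `G` is a fragmentation of `⟨a, b, c⟩`, obtained by fragmenting `c` along the three pieces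
    FragK110.IsFragmentation FragK110.H FragK110.c
      (Set.range fun j : Fin 3 => FragK110.piece j ∩ {w | FragK110.c w ≠ w}) ∧
    FragK110.IsFragmentationGroup {FragK110.a, FragK110.b, FragK110.c} FragK110.G ∧
    -- `0^ω` is the purely non-Hausdorff singularity of `G`
    (∀ ζ : FragK110.Word,
      FragK110.IsPurelyNonHausdorff FragK110.gens ζ ↔ ζ = FragK110.zeroWord) ∧
    -- its group of germs is `⟨c₀, c₁, c₂⟩`, isomorphic to `(ℤ/2)²`
    Nonempty (FragK110.H ≃* Multiplicative (ZMod 2 × ZMod 2)) ∧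
    Nonempty (FragK110.GermGroup FragK110.G FragK110.zeroWord ≃*
      Multiplicative (ZMod 2 × ZMod 2)) ∧
    (∀ h ∈ FragK110.H, h FragK110.zeroWord = FragK110.zeroWord) ∧
    (∀ g ∈ FragK110.G, g FragK110.zeroWord = FragK110.zeroWord →
      ∃! h : FragK110.Word ≃ₜ FragK110.Word,
        h ∈ FragK110.H ∧ ∀ᶠ x in nhds FragK110.zeroWord, g x = h x) ∧
    -- the growth estimate
    ∃ η : ℝ, (∀ x : ℝ, (0 < x ∧ x ^ 5 + x ^ 4 + x ^ 3 - 2 = 0) ↔ x = η) ∧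
      |η - 0.9028| < 0.00005 ∧
      |Real.log 2 / (Real.log 2 - Real.log η) - 0.8715| < 0.00005 ∧
      ∀ α : ℝ, Real.log 2 / (Real.log 2 - Real.log η) < α →
        FragK110.Dominated (fun R => (FragK110.growth FragK110.gens R : ℝ))
          (fun R => Real.exp (R ^ α)) := by
  refine ⟨FragK110.wreath_c₀, FragK110.wreath_c₁, FragK110.wreath_c₂, FragK110.isFragmentation_H,
    FragK110.isFragmentationGroup_G, FragK110.isPurelyNonHausdorff_iff, ?_, ?_,
    fun h hh => FragK110.H_fix hh, fun g hg h0 => FragK110.existsUnique_H_germ hg h0, ?_⟩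
  · have := FragK110.H_isKleinFour
    exact IsKleinFour.nonempty_mulEquiv
  · have := FragK110.H_isKleinFour
    obtain ⟨e⟩ := FragK110.germGroup_equiv
    obtain ⟨f⟩ : Nonempty (FragK110.H ≃* Multiplicative (ZMod 2 × ZMod 2)) :=
      IsKleinFour.nonempty_mulEquiv
    exact ⟨e.symm.trans f⟩
  · obtain ⟨η, h1, h2, hη⟩ := FragK110.exists_root
    refine ⟨η, fun x => ⟨fun hx => ?_, ?_⟩, ?_, FragK110.exponent_bounds h1 h2, fun α hα => ?_⟩
    · exact FragK110.strictMonoOn_quintic.injOn (Set.mem_Ici.2 hx.1.le)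
        (Set.mem_Ici.2 (by linarith)) (hx.2.trans hη.symm)
    · rintro rfl
      exact ⟨by linarith, hη⟩
    · rw [abs_lt]
      constructor <;> linarith
    -- Concavity of `x ^ α` needs an exponent of at most `1`; larger `α` follow by monotonicity, as
    -- the critical exponent is below `1`.
    · have hlt : Real.log 2 / (Real.log 2 - Real.log η) < min α 1 := by
        refine lt_min hα ?_
        have := (abs_lt.1 (FragK110.exponent_bounds h1 h2)).2
        linarith
      have hpos : 0 < Real.log 2 / (Real.log 2 - Real.log η) := by
        have := (abs_lt.1 (FragK110.exponent_bounds h1 h2)).1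
        linarith
      exact (FragK110.growth_dominated (by linarith) (by linarith) hη (hpos.trans hlt)
        (min_le_right _ _) (FragK110.two_mul_rpow_lt_one (by linarith) (by linarith) hlt)).exp_rpow_mono
        (min_le_left _ _)
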